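/- **Setting.** Let $H^1=H^1(\mathbb R;\mathbb C)$ with norm $\|u\|^2=\|u\|_{L^2}^2+\|u_x\|_{L^2}^2$ and let $H^{-1}$ be its topological dual, with $H^1\subset H^{-1}$ through $u\mapsto\bigl(v\mapsto\int_{\mathbb R}uv\,dx\bigr)$. Fix $x_0>0$. For $\beta\ge 0$ let $A_\beta$ be the unbounded operator in $H^{-1}$ with domain $H^1$ given by $$\langle A_\beta u,v\rangle=\int_{\mathbb R}u_xv_x\,dx+\beta\,u(x_0)\,v(0),\qquad u,v\in H^1,$$ that is, $-A_\beta=\partial_{xx}-\beta\,\delta_0\delta_{x_0}^\top$, where point values are those of continuous representatives. Write $\sigma$ for the spectrum, $\sigma_p$ for the set of eigenvalues, and $\sigma_c$ for the continuous spectrum (the $\lambda\in\sigma$ for which $\lambda+A_\beta$ is injective with dense range). Put $$\beta_0=\frac{\pi}{x_0},\qquad \beta_1=\frac{1}{x_0}\,\frac{3\pi}{\sqrt2}\,e^{3\pi/4},$$ so that $\beta_0=\pi$ and $\beta_1=\frac{3\pi}{\sqrt2}e^{3\pi/4}$ when $x_0=1$. **Proposition.** One has $\beta_0<\beta_1$,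 and the following hold. 1. If $0\le\beta<\beta_0$, then $\sigma(-A_\beta)=\sigma_c(-A_\beta)=(-\infty,0]$ and $\sigma_p(-A_\beta)=\emptyset$. 2. If $\beta_0<\beta<\beta_1$, then $\sigma_c(-A_\beta)=(-\infty,0]$, and $\sigma_p(-A_\beta)$ is a nonempty finite set of non-real numbers in the open left half-plane $\{\operatorname{Re}\lambda<0\}$ that is closed under complex conjugation; each of its elements is an isolated point of $\sigma(-A_\beta)$. The point spectrum varies with $\beta$: for different $\beta,\beta'\in(\beta_0,\beta_1)$ the sets $\sigma_p(-A_\beta)$ and $\sigma_p(-A_{\beta'})$ are disjoint. 3. For $\beta=\beta_1$ there is $\omega>0$ such that $\pm i\omega$ are exactly the eigenvalues of $-A_{\beta_1}$ with $\operatorname{Re}\lambda\ge0$. 4. For every $\beta\ge0$: $\sigma_c(-A_\beta)=(-\infty,0]$, $\sigma(-A_\beta)=(-\infty,0]\cup\sigma_p(-A_\beta)$, and $\sigma_p(-A_\beta)$ is finite and contains no real number. 5. There are strictly increasing real sequences $(e_k)_{k\ge0}$ and $(c_k)_{k\ge0}$ with $e_0=\beta_0$, $c_0=\beta_1$, $e_k<c_k$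 for all $k$, and $e_k\to\infty$, and functions $\lambda_k:(e_k,\infty)\to\mathbb C$, such that for every $\beta\ge0$ $$\sigma_p(-A_\beta)=\bigl\{\lambda_k(\beta),\ \overline{\lambda_k(\beta)}\ :\ k\ge0,\ e_k<\beta\bigr\},$$ where the numbers $\lambda_k(\beta)$ with $e_k<\beta$ are pairwise different, and such that for every $k$: - $\lambda_k$ is continuous, and $\operatorname{Im}\lambda_k(\beta)>0$ for all $\beta>e_k$; so the pair is never on the real axis; - as $\beta\downarrow e_k$, $\lambda_k(\beta)$ converges to a point of $(-\infty,0)$; so the pair is ejected from the continuous spectrum at $\beta=e_k$; - $\arg\lambda_k(\beta)\in(0,\pi)$ is strictly decreasing in $\beta$; so the pair migrates towards the imaginary axis and, after crossing it, moves away from it; - $\operatorname{Re}\lambda_k(\beta)<0$ for $e_k<\beta<c_k$, $\operatorname{Re}\lambda_k(c_k)=0$, and $\operatorname{Re}\lambda_k(\beta)>0$ for $\beta>c_k$; so the pairs cross the imaginary axis into the right half-plane one after the other, and the first one crosses at $\beta_1$; - $\operatorname{Im}\lambda_k(\beta)\to\infty$ as $\beta\to\infty$; so the pair does not rejoin on the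 positive real axis in the limit either. -/

import Mathlib

open MeasureTheory Set Filter Topology
open scoped ContDiff

noncomputable section

namespace HeatLine

/-- `g` is the weak (distributional) derivative of `u` on the real line, tested against all
smooth compactly supported functions. -/
def HasWeakDeriv (u g : ℝ → ℂ) : Prop :=
  ∀ φ : ℝ → ℝ, ContDiff ℝ ∞ φ → HasCompactSupport φ →
    ∫ x, deriv φ x • u x = -∫ x, φ x • g x

/-- Integration by parts of a test function against the primitive of a locally integrable function. -/
theorem integral_deriv_mul_primitive (g φ : ℝ → ℝ) (hg : LocallyIntegrable g)
    (hφ : ContDiff ℝ ∞ φ) (hs : HasCompactSupport φ) :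
    ∫ x, deriv φ x * (∫ y in (0 : ℝ)..x, g y) = -∫ x, φ x * g x := by
  obtain ⟨R, hR0, hR⟩ : ∃ R : ℝ, 0 < R ∧ tsupport φ ⊆ Ioo (-R) R := by
    obtain ⟨r, hr⟩ := hs.isBounded.subset_ball 0
    refine ⟨max r 1, by positivity, hr.trans ?_⟩
    rw [Real.ball_eq_Ioo]
    apply Ioo_subset_Ioo <;> simp
  have h1 : ∀ x, x ∉ Ioc (-R) R → φ x = 0 := fun x hx =>
    image_eq_zero_of_notMem_tsupport fun h => hx (Ioo_subset_Ioc_self (hR h))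
  have h2 : ∀ x, x ∉ Ioc (-R) R → deriv φ x = 0 := fun x hx =>
    image_eq_zero_of_notMem_tsupport fun h =>
      hx (Ioo_subset_Ioc_self (hR (tsupport_deriv_subset h)))
  have hle : -R ≤ R := by linarith
  have hint : IntervalIntegrable g volume (-R) R :=
    (hg.integrableOn_isCompact isCompact_uIcc).intervalIntegrable
  have hG := hint.absolutelyContinuousOnInterval_intervalIntegral (c := 0)
    (by rw [uIcc_of_le hle]; constructor <;> linarith)
  have hφac : AbsolutelyContinuousOnInterval φ (-R) R :=
    (hφ.of_le (by norm_cast)).contDiffOn.absolutelyContinuousOnInterval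
  have key := hφac.integral_mul_deriv_eq_deriv_mul hG
  have e1 : φ R = 0 := image_eq_zero_of_notMem_tsupport fun h => by have := (hR h).2; simp at this
  have e2 : φ (-R) = 0 := image_eq_zero_of_notMem_tsupport fun h => by
    have := (hR h).1; simp at this
  rw [e1, e2] at key
  have e3 : ∫ x in (-R)..R, φ x * deriv (fun x => ∫ y in (0 : ℝ)..x, g y) x
      = ∫ x in (-R)..R, φ x * g x := by
    apply intervalIntegral.integral_congr_ae
    filter_upwards [_root_.LocallyIntegrable.ae_hasDerivAt_integral hg] with x hx _
    rw [(hx 0).deriv]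
  have f1 : ∫ x, deriv φ x * (∫ y in (0 : ℝ)..x, g y)
      = ∫ x in (-R)..R, deriv φ x * (∫ y in (0 : ℝ)..x, g y) := by
    rw [intervalIntegral.integral_of_le hle, setIntegral_eq_integral_of_forall_compl_eq_zero]
    intro x hx; simp [h2 x hx]
  have f2 : ∫ x, φ x * g x = ∫ x in (-R)..R, φ x * g x := by
    rw [intervalIntegral.integral_of_le hle, setIntegral_eq_integral_of_forall_compl_eq_zero]
    intro x hx; simp [h1 x hx]
  rw [f1, f2, ← e3, key]; ring

/-- A locally integrable function whose weak derivative vanishes is constant almost everywhere. -/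
theorem ae_const_of_weakDeriv_zero (v : ℝ → ℝ) (hv : LocallyIntegrable v)
    (h : ∀ φ : ℝ → ℝ, ContDiff ℝ ∞ φ → HasCompactSupport φ → ∫ x, deriv φ x * v x = 0) :
    ∃ c : ℝ, ∀ᵐ x, v x = c := by
  let χ : ContDiffBump (0 : ℝ) := default
  let n : ℝ → ℝ := χ.normed volume
  have hn : ContDiff ℝ ∞ n := χ.contDiff_normed
  have hnc : HasCompactSupport n := χ.hasCompactSupport_normed
  have hn1 : ∫ x, n x = 1 := χ.integral_normed
  have hvi : ∀ ψ : ℝ → ℝ, ContDiff ℝ ∞ ψ → HasCompactSupport ψ →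
      Integrable fun x => ψ x * v x := fun ψ h1 h2 =>
    hv.integrable_smul_left_of_hasCompactSupport h1.continuous h2
  refine ⟨∫ x, n x * v x, ae_eq_of_integral_contDiff_smul_eq hv
    (continuous_const.locallyIntegrable) ?_⟩
  intro ψ hψ hψc
  simp only [smul_eq_mul]
  set I := ∫ x, ψ x with hI
  let θ : ℝ → ℝ := fun x => ψ x - I * n x
  have hθ : ContDiff ℝ ∞ θ := hψ.sub (contDiff_const.mul hn)
  have hθc : HasCompactSupport θ := hψc.sub (hnc.mul_left)
  have hθi : Integrable θ := hθ.continuous.integrable_of_hasCompactSupport hθc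
  have hθ0 : ∫ x, θ x = 0 := by
    simp only [θ]
    rw [integral_sub (hψ.continuous.integrable_of_hasCompactSupport hψc)
      ((hn.continuous.integrable_of_hasCompactSupport hnc).const_mul _), integral_const_mul, hn1]
    simp [hI]
  let φ : ℝ → ℝ := fun x => ∫ y in Iic x, θ y
  obtain ⟨R, hR0, hR⟩ : ∃ R : ℝ, 0 < R ∧ tsupport θ ⊆ Ioo (-R) R := by
    obtain ⟨r, hr⟩ := hθc.isBounded.subset_ball 0
    refine ⟨max r 1, by positivity, hr.trans ?_⟩
    rw [Real.ball_eq_Ioo]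
    apply Ioo_subset_Ioo <;> simp
  have hz : ∀ x, x ∉ Ioo (-R) R → θ x = 0 := fun x hx =>
    image_eq_zero_of_notMem_tsupport fun h => hx (hR h)
  have hφd : ∀ x, HasDerivAt φ (θ x) x := by
    intro x
    have e : φ = fun x => (∫ y in Iic (0:ℝ), θ y) + ∫ y in (0:ℝ)..x, θ y := by
      funext x
      rw [← intervalIntegral.integral_Iic_sub_Iic hθi.integrableOn hθi.integrableOn]
      simp [φ]
    rw [e]
    exact (intervalIntegral.integral_hasDerivAt_right (hθ.continuous.intervalIntegrable _ _)
      (hθ.continuous.stronglyMeasurableAtFilter _ _) hθ.continuous.continuousAt).const_add _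
  have hder : deriv φ = θ := funext fun x => (hφd x).deriv
  have hφs : ContDiff ℝ ∞ φ := by
    rw [contDiff_infty_iff_deriv]
    exact ⟨fun x => (hφd x).differentiableAt, hder ▸ hθ⟩
  have hφc : HasCompactSupport φ := by
    refine HasCompactSupport.intro (isCompact_Icc (a := -R) (b := R)) fun x hx => ?_
    simp only [φ]
    rcases lt_or_ge x (-R) with hlt | hge
    · refine setIntegral_eq_zero_of_forall_eq_zero fun y hy => hz y fun hy' => ?_
      have := mem_Iic.1 hy; have := hy'.1; linarith
    · have hx' : R < x := by
        by_contra hc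
        exact hx ⟨hge, not_lt.1 hc⟩
      rw [setIntegral_eq_integral_of_forall_compl_eq_zero, hθ0]
      intro y hy
      refine hz y fun hy' => hy ?_
      have := hy'.2; exact mem_Iic.2 (by linarith)
  have := h φ hφs hφc
  rw [hder] at this
  have e2 : (fun x => θ x * v x) = fun x => ψ x * v x - I * (n x * v x) := by
    funext x; simp only [θ]; ring
  rw [e2, integral_sub (hvi ψ hψ hψc) ((hvi n hn hnc).const_mul _), integral_const_mul] at this
  rw [integral_mul_const]
  linarith

/-- A function with weak derivative `g` is almost everywhere a primitive of `g`. -/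
theorem HasWeakDeriv.exists_primitive {u g : ℝ → ℂ} (hu : LocallyIntegrable u)
    (hg : LocallyIntegrable g) (h : HasWeakDeriv u g) :
    ∃ c : ℂ, ∀ᵐ x, u x = c + ∫ y in (0 : ℝ)..x, g y := by
  have main : ∀ L : ℂ →L[ℝ] ℝ, ∃ c : ℝ, ∀ᵐ x, L (u x) = c + L (∫ y in (0 : ℝ)..x, g y) := by
    intro L
    have hLu : LocallyIntegrable fun x => L (u x) := fun x =>
      let ⟨s, hs, hi⟩ := hu x; ⟨s, hs, L.integrable_comp hi⟩
    have hLg : LocallyIntegrable fun x => L (g x) := fun x =>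
      let ⟨s, hs, hi⟩ := hg x; ⟨s, hs, L.integrable_comp hi⟩
    have hii : ∀ a b, IntervalIntegrable g volume a b := fun a b =>
      (hg.integrableOn_isCompact isCompact_uIcc).intervalIntegrable
    have hLint : ∀ x, L (∫ y in (0 : ℝ)..x, g y) = ∫ y in (0 : ℝ)..x, L (g y) := fun x =>
      (L.intervalIntegral_comp_comm (hii 0 x)).symm
    have hGc : Continuous fun x => ∫ y in (0 : ℝ)..x, L (g y) :=
      intervalIntegral.continuous_primitive (fun a b =>
        (hLg.integrableOn_isCompact isCompact_uIcc).intervalIntegrable) 0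
    obtain ⟨c, hc⟩ := ae_const_of_weakDeriv_zero
      (fun x => L (u x) - ∫ y in (0 : ℝ)..x, L (g y)) (hLu.sub hGc.locallyIntegrable) (by
        intro φ hφ hφc
        have hd : Continuous (deriv φ) := hφ.continuous_deriv (by simp)
        have e := congrArg L (h φ hφ hφc)
        rw [map_neg, ← L.integral_comp_comm
            (hu.integrable_smul_left_of_hasCompactSupport hd hφc.deriv),
          ← L.integral_comp_comm
            (hg.integrable_smul_left_of_hasCompactSupport hφ.continuous hφc)] at e
        simp only [map_smul, smul_eq_mul] at e
        have e2 := integral_deriv_mul_primitive _ φ hLg hφ hφc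
        simp only [mul_sub]
        rw [integral_sub, e, e2, sub_self]
        · exact hLu.integrable_smul_left_of_hasCompactSupport hd hφc.deriv
        · exact (hd.mul hGc).integrable_of_hasCompactSupport hφc.deriv.mul_right)
    refine ⟨c, hc.mono fun x hx => ?_⟩
    rw [hLint]; linarith
  obtain ⟨a, ha⟩ := main Complex.reCLM
  obtain ⟨b, hb⟩ := main Complex.imCLM
  refine ⟨⟨a, b⟩, ?_⟩
  filter_upwards [ha, hb] with x hx hy
  apply Complex.ext
  · simpa using hx
  · simpa using hy

/-- Complex-valued square integrable functions on the real line. -/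
abbrev L2 := Lp ℂ 2 (volume : Measure ℝ)

theorem L2.locallyIntegrable (f : L2) : LocallyIntegrable f :=
  (Lp.memLp f).locallyIntegrable (by norm_num)

/-- The Sobolev space `H¹(ℝ; ℂ)`: pairs `(u, g)` of `L²` functions such that `g` is the weak
derivative of `u` (so `g` is determined by `u`). The norm inherited from the `ℓ²` product is
`‖u‖² = ‖u‖²_{L²} + ‖g‖²_{L²}`. -/
def H1 : Submodule ℂ (WithLp 2 (L2 × L2)) where
  carrier := {p | HasWeakDeriv p.fst p.snd}
  zero_mem' := by
    intro φ _ _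
    have h0 : ((0 : L2) : ℝ → ℂ) =ᵐ[volume] 0 := Lp.coeFn_zero _ _ _
    have e : ∀ ψ : ℝ → ℝ, ∫ x, ψ x • (0 : L2) x = 0 := fun ψ =>
      integral_eq_zero_of_ae (h0.mono fun x hx => by simp only [hx, Pi.zero_apply, smul_zero])
    rw [WithLp.zero_fst, WithLp.zero_snd, e, e, neg_zero]
  add_mem' := by
    intro p q hp hq φ hφ hφc
    have hd : Continuous (deriv φ) := hφ.continuous_deriv (by simp)
    have e : ∀ ψ : ℝ → ℝ, Continuous ψ → HasCompactSupport ψ → ∀ f g : L2,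
        ∫ x, ψ x • (f + g : L2) x = (∫ x, ψ x • f x) + ∫ x, ψ x • g x := by
      intro ψ h1 h2 f g
      rw [← integral_add ((L2.locallyIntegrable f).integrable_smul_left_of_hasCompactSupport h1 h2)
        ((L2.locallyIntegrable g).integrable_smul_left_of_hasCompactSupport h1 h2)]
      refine integral_congr_ae ((Lp.coeFn_add f g).mono fun x hx => ?_)
      simp only [hx, Pi.add_apply, smul_add]
    rw [WithLp.add_fst, WithLp.add_snd, e _ hd hφc.deriv, e _ hφ.continuous hφc,
      hp φ hφ hφc, hq φ hφ hφc]
    ring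
  smul_mem' := by
    intro c p hp φ hφ hφc
    have e : ∀ ψ : ℝ → ℝ, ∀ f : L2, ∫ x, ψ x • (c • f : L2) x = c * ∫ x, ψ x • f x := by
      intro ψ f
      rw [← integral_const_mul]
      refine integral_congr_ae ((Lp.coeFn_smul c f).mono fun x hx => ?_)
      simp only [hx, Pi.smul_apply, smul_eq_mul, Complex.real_smul]; ring
    rw [WithLp.smul_fst, WithLp.smul_snd, e, e, hp φ hφ hφc]
    ring

namespace H1

/-- The inclusion of `H¹` into `L²`. -/
def toL2 : H1 →L[ℂ] L2 := (WithLp.fstL 2 ℂ L2 L2).comp H1.subtypeL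

/-- The weak derivative `H¹ → L²`. -/
def derivL2 : H1 →L[ℂ] L2 := (WithLp.sndL 2 ℂ L2 L2).comp H1.subtypeL

/-- Each element of `H¹` has a continuous representative, and it is a primitive of the weak
derivative. -/
theorem exists_rep (u : H1) : ∃ f : ℝ → ℂ, Continuous f ∧ f =ᵐ[volume] toL2 u ∧
    ∀ a b, f b - f a = ∫ y in a..b, derivL2 u y := by
  have hg := L2.locallyIntegrable (derivL2 u)
  have hii : ∀ a b, IntervalIntegrable (derivL2 u) volume a b := fun a b =>
    (hg.integrableOn_isCompact isCompact_uIcc).intervalIntegrable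
  obtain ⟨c, hc⟩ := HasWeakDeriv.exists_primitive (L2.locallyIntegrable (toL2 u)) hg u.2
  refine ⟨fun x => c + ∫ y in (0 : ℝ)..x, derivL2 u y,
    continuous_const.add (intervalIntegral.continuous_primitive hii 0), ?_, fun a b => ?_⟩
  · filter_upwards [hc] with x hx using hx.symm
  · rw [add_sub_add_left_eq_sub, intervalIntegral.integral_interval_sub_left (hii _ _) (hii _ _)]

/-- The (unique) continuous representative of an element of `H¹`. -/
def rep (u : H1) : ℝ → ℂ := (exists_rep u).choose

theorem continuous_rep (u : H1) : Continuous (rep u) := (exists_rep u).choose_spec.1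
theorem rep_ae_eq (u : H1) : rep u =ᵐ[volume] toL2 u := (exists_rep u).choose_spec.2.1
theorem rep_sub (u : H1) (a b : ℝ) : rep u b - rep u a = ∫ y in a..b, derivL2 u y :=
  (exists_rep u).choose_spec.2.2 a b

theorem eq_rep {u : H1} {f : ℝ → ℂ} (hf : Continuous f) (h : f =ᵐ[volume] toL2 u) : f = rep u :=
  Continuous.ae_eq_iff_eq volume hf (continuous_rep u) |>.1 (h.trans (rep_ae_eq u).symm)

theorem setIntegral_norm_le (f : L2) (x : ℝ) : ∫ y in Ioc x (x + 1), ‖f y‖ ≤ ‖f‖ := by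
  have : IsProbabilityMeasure ((volume : Measure ℝ).restrict (Ioc x (x + 1))) := ⟨by simp⟩
  have hm := (Lp.memLp f).restrict (Ioc x (x + 1))
  have h1 : eLpNorm f 1 (volume.restrict (Ioc x (x + 1))) ≤ eLpNorm f 2 volume :=
    (eLpNorm_le_eLpNorm_of_exponent_le (by norm_num) hm.1).trans
      (eLpNorm_mono_measure _ Measure.restrict_le_self)
  rw [integral_norm_eq_lintegral_enorm hm.1, ← eLpNorm_one_eq_lintegral_enorm, Lp.norm_def]
  exact ENNReal.toReal_mono (Lp.memLp f).eLpNorm_ne_top h1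

theorem norm_rep_le (u : H1) (x : ℝ) : ‖rep u x‖ ≤ 2 * ‖u‖ := by
  have hg := L2.locallyIntegrable (derivL2 u)
  have hi : IntegrableOn (fun y => ‖derivL2 u y‖) (Ioc x (x + 1)) :=
    ((hg.integrableOn_isCompact (isCompact_Icc (a := x) (b := x + 1))).mono_set
      Ioc_subset_Icc_self).norm
  have hc : IntegrableOn (fun y => ‖rep u y‖) (Ioc x (x + 1)) :=
    ((continuous_rep u).norm.integrableOn_Icc).mono_set Ioc_subset_Icc_self
  have key : ∀ y ∈ Ioc x (x + 1), ‖rep u x‖ - ∫ z in Ioc x (x + 1), ‖derivL2 u z‖ ≤ ‖rep u y‖ := by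
    intro y hy
    have h1 : ‖rep u y - rep u x‖ ≤ ∫ z in Ioc x (x + 1), ‖derivL2 u z‖ := by
      rw [rep_sub, intervalIntegral.integral_of_le hy.1.le]
      refine (norm_integral_le_integral_norm _).trans ?_
      exact setIntegral_mono_set hi (ae_of_all _ fun _ => norm_nonneg _)
        (Ioc_subset_Ioc_right hy.2).eventuallyLE
    have h2 := norm_sub_norm_le (rep u x) (rep u y)
    rw [norm_sub_rev] at h2
    linarith
  have h3 := setIntegral_mono_on (μ := volume) (by simp) hc measurableSet_Ioc key
  have e : ∫ y in Ioc x (x + 1), ‖rep u y‖ = ∫ y in Ioc x (x + 1), ‖toL2 u y‖ :=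
    integral_congr_ae (ae_restrict_of_ae ((rep_ae_eq u).mono fun y hy => by simp [hy]))
  rw [e] at h3
  simp at h3
  have h4 := setIntegral_norm_le (toL2 u) x
  have h5 := setIntegral_norm_le (derivL2 u) x
  have h6 : ‖toL2 u‖ ≤ ‖u‖ := WithLp.norm_fst_le _ (u : WithLp 2 (L2 × L2))
  have h7 : ‖derivL2 u‖ ≤ ‖u‖ := WithLp.norm_snd_le _ (u : WithLp 2 (L2 × L2))
  linarith

/-- The Dirac functional `δ_x`, i.e. evaluation at `x` of the continuous representative. -/
def eval (x : ℝ) : H1 →L[ℂ] ℂ :=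
  LinearMap.mkContinuous
    { toFun := fun u => rep u x
      map_add' := fun u v => by
        refine (congrFun (eq_rep (f := fun x => rep u x + rep v x)
          ((continuous_rep u).add (continuous_rep v)) ?_) x).symm
        rw [map_add]
        filter_upwards [rep_ae_eq u, rep_ae_eq v, Lp.coeFn_add (toL2 u) (toL2 v)] with y h1 h2 h3
        simp only [h1, h2, h3, Pi.add_apply]
      map_smul' := fun c u => by
        refine (congrFun (eq_rep (f := fun x => c * rep u x)
          (continuous_const.mul (continuous_rep u)) ?_) x).symm
        rw [map_smul]
        filter_upwards [rep_ae_eq u, Lp.coeFn_smul c (toL2 u)] with y h1 h3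
        simp only [h1, h3, Pi.smul_apply, smul_eq_mul] }
    2 (fun u => norm_rep_le u x)

end H1

/-- `H⁻¹(ℝ)`, the topological dual of `H¹(ℝ)`, with the operator norm. -/
abbrev Hneg1 := StrongDual ℂ H1

/-- The bilinear pairing `(f, g) ↦ ∫ f g` on `L²` (no conjugation). -/
def L2.pairing : L2 →L[ℂ] L2 →L[ℂ] ℂ := (ContinuousLinearMap.mul ℂ ℂ).lpPairing volume 2 2

/-- The embedding `H¹ ⊂ H⁻¹`: `u ↦ (v ↦ ∫ u v)`. -/
def H1.toHneg1 : H1 →L[ℂ] Hneg1 := L2.pairing.bilinearComp H1.toL2 H1.toL2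

/-- The map `A : H¹ → H⁻¹` induced by the Dirichlet form: `u ↦ (v ↦ ∫ u_x v_x)`. -/
def dirichletForm : H1 →L[ℂ] Hneg1 := L2.pairing.bilinearComp H1.derivL2 H1.derivL2

theorem H1.toHneg1_apply (u v : H1) : toHneg1 u v = ∫ x, toL2 u x * toL2 v x := by
  simp [toHneg1, L2.pairing, ContinuousLinearMap.lpPairing_eq_integral]

theorem dirichletForm_apply (u v : H1) :
    dirichletForm u v = ∫ x, H1.derivL2 u x * H1.derivL2 v x := by
  simp [dirichletForm, L2.pairing, ContinuousLinearMap.lpPairing_eq_integral]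

theorem H1.exists_conj (u : H1) : ∃ v : H1, toL2 v = star (toL2 u) := by
  refine ⟨⟨WithLp.toLp 2 (star (toL2 u), star (derivL2 u)), ?_⟩, rfl⟩
  intro φ hφ hφc
  have e : ∀ ψ : ℝ → ℝ, ∀ f : L2, ∫ x, ψ x • (star f : L2) x = star (∫ x, ψ x • f x) := by
    intro ψ f
    rw [show ∀ z : ℂ, star z = (starRingEnd ℂ) z from fun _ => rfl, ← integral_conj]
    refine integral_congr_ae ((Lp.coeFn_star f).mono fun x hx => ?_)
    simp only [hx, Pi.star_apply, Complex.real_smul, map_mul, Complex.conj_ofReal]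
    rfl
  have h := u.2 φ hφ hφc
  change ∫ x, deriv φ x • (star (toL2 u) : L2) x = -∫ x, φ x • (star (derivL2 u) : L2) x
  rw [e, e, ← star_neg]
  exact congrArg star h

theorem H1.toL2_injective : Function.Injective toL2 := by
  rw [injective_iff_map_eq_zero]
  intro u hu
  have hu0 : (toL2 u : ℝ → ℂ) =ᵐ[volume] 0 := by rw [hu]; exact Lp.coeFn_zero _ _ _
  have h1 : ∀ᵐ x, derivL2 u x = 0 := by
    refine ae_eq_zero_of_integral_contDiff_smul_eq_zero (L2.locallyIntegrable _) ?_
    intro φ hφ hφc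
    have h := u.2 φ hφ hφc
    have h2 : ∫ x, deriv φ x • toL2 u x = 0 :=
      integral_eq_zero_of_ae (hu0.mono fun x hx => by simp only [hx, Pi.zero_apply, smul_zero])
    exact neg_eq_zero.1 (h.symm.trans h2)
  have h2 : derivL2 u = 0 := (Lp.eq_zero_iff_ae_eq_zero).2 h1
  apply Subtype.ext
  apply WithLp.ofLp_injective
  exact Prod.ext hu h2

theorem H1.toHneg1_injective : Function.Injective toHneg1 := by
  rw [injective_iff_map_eq_zero]
  intro u hu
  obtain ⟨v, hv⟩ := exists_conj u
  have h : ∫ x, toL2 u x * toL2 v x = 0 := by rw [← toHneg1_apply, hu]; rfl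
  have h2 : inner ℂ (toL2 u) (toL2 u) = 0 := by
    rw [L2.inner_def, ← h, hv]
    refine integral_congr_ae ((Lp.coeFn_star (toL2 u)).mono fun x hx => ?_)
    simp only [hx, Pi.star_apply, RCLike.inner_apply]
    rfl
  exact (injective_iff_map_eq_zero toL2).1 toL2_injective u (inner_self_eq_zero.1 h2)

/-- The unbounded operator `A_β = A + β δ₀ δ_{x₀}ᵀ` in `H⁻¹` with domain `H¹` (viewed inside `H⁻¹`),
`A_β u = (v ↦ ∫ u_x v_x + β u(x₀) v(0))`. -/
def opA (x₀ β : ℝ) : Hneg1 →ₗ.[ℂ] Hneg1 where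
  domain := H1.toHneg1.range
  toFun := (dirichletForm + (β : ℂ) • (H1.eval x₀).smulRight (H1.eval 0)).toLinearMap ∘ₗ
    (LinearEquiv.ofInjective H1.toHneg1.toLinearMap H1.toHneg1_injective).symm.toLinearMap

theorem opA_apply (x₀ β : ℝ) (u : H1) :
    opA x₀ β ⟨H1.toHneg1 u, ⟨u, rfl⟩⟩ =
      dirichletForm u + ((β : ℂ) * H1.eval x₀ u) • H1.eval 0 := by
  have : (LinearEquiv.ofInjective H1.toHneg1.toLinearMap H1.toHneg1_injective).symm
     ⟨H1.toHneg1 u, ⟨u, rfl⟩⟩ = u := by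
    rw [LinearEquiv.symm_apply_eq]; rfl
  simp [opA, this, smul_smul]

/-! ### Spectrum of an unbounded operator in a Banach space (only its linear topology enters) -/

/-- The resolvent set: those `z` for which `z - T` has an everywhere defined bounded inverse. -/
def resolventSet {X : Type*} [AddCommGroup X] [Module ℂ X] [TopologicalSpace X]
    (T : X →ₗ.[ℂ] X) : Set ℂ :=
  {z | ∃ R : X →L[ℂ] X,
    (∀ f : X, ∃ u : T.domain, (u : X) = R f ∧ z • (u : X) - T u = f) ∧
    ∀ u : T.domain, R (z • (u : X) - T u) = u}

/-- The spectrum. -/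
def spec {X : Type*} [AddCommGroup X] [Module ℂ X] [TopologicalSpace X]
    (T : X →ₗ.[ℂ] X) : Set ℂ :=
  (resolventSet T)ᶜ

/-- The point spectrum (set of eigenvalues). -/
def pointSpec {X : Type*} [AddCommGroup X] [Module ℂ X] [TopologicalSpace X]
    (T : X →ₗ.[ℂ] X) : Set ℂ :=
  {z | ∃ u : T.domain, u ≠ 0 ∧ T u = z • (u : X)}

/-- The continuous spectrum: those `z` in the spectrum for which `z - T` is injective with dense
range. -/
def contSpec {X : Type*} [AddCommGroup X] [Module ℂ X] [TopologicalSpace X]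
    (T : X →ₗ.[ℂ] X) : Set ℂ :=
  {z | z ∈ spec T ∧ Function.Injective (fun u : T.domain => z • (u : X) - T u) ∧
    DenseRange (fun u : T.domain => z • (u : X) - T u)}

/-- The half-line `(-∞, 0]` in the complex plane. -/
def nonposReals : Set ℂ := {z | z.re ≤ 0 ∧ z.im = 0}

end HeatLine

end

open HeatLine

noncomputable section

set_option maxSynthPendingDepth 3

namespace HeatLine

/-! Off the half-line every `z` is `μ ^ 2` with `0 < re μ`. There `z + A` without the point term is
an isomorphism from `H1` to its dual by Lax–Milgram (`bijective_shiftedForm`), and `exp (-μ |x|)` is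
mapped to `2μ δ₀` (`dirichletForm_expH1`). The point term has rank one with range spanned by `δ₀`,
so everything reduces to a scalar: `z` is an eigenvalue if `2μ + β exp (-μ x₀) = 0` and lies in the
resolvent set otherwise (`pencil_expH1`, `bijective_pencil`).

At `z = -s²` the same exponentials with `μ = ε + i s` and `ε → 0` do all the work. Used as test
functions, they show that an `H1` solution of `-w'' - s² w = c δ_p` vanishes
(`eq_zero_of_shiftedForm_eq`). This gives injectivity and, applied to the transposed equation, dense
range. Used as quasimodes, they rule out a bounded resolvent
(`notMem_resolventSet_of_mem_nonposReals`).

For the characteristic equation put `μ x₀ = ρ exp (iθ)`. Comparing arguments gives `ρ sin θ =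
(2k+1)π - θ`, so each branch `k` is a curve parametrised by `θ ∈ (0, π/2)`; comparing moduli gives
`β` as an explicit function of `θ`. That function is strictly decreasing
(`strictAntiOn_branchParam`), so it can be inverted. The eigenvalue `μ ^ 2` has argument `2θ`: the
pair emerges from the half-line at `θ = π/2` and crosses the imaginary axis at `θ = π/4`. -/

/-! ### Integration by parts and weak derivatives. -/

theorem absolutelyContinuousOnInterval_primitive {g : ℝ → ℂ} (hg : LocallyIntegrable g) (a b : ℝ) :
    AbsolutelyContinuousOnInterval (fun x => ∫ y in a..x, g y) a b := by
  have hii : ∀ a b, IntervalIntegrable g volume a b := fun a b =>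
    (hg.integrableOn_isCompact isCompact_uIcc).intervalIntegrable
  have hre : IntervalIntegrable (fun x => (g x).re) volume a b := ⟨(hii a b).1.re, (hii a b).2.re⟩
  have him : IntervalIntegrable (fun x => (g x).im) volume a b := ⟨(hii a b).1.im, (hii a b).2.im⟩
  -- The real-valued theorem is applied to the real and imaginary parts, which are recombined with
  -- the constant coefficients `1` and `I`.
  have h1 := (hre.absolutelyContinuousOnInterval_intervalIntegral (c := a) (by simp)).smul
    (contDiff_const (c := (1 : ℂ))).contDiffOn.absolutelyContinuousOnInterval
  have h2 := (him.absolutelyContinuousOnInterval_intervalIntegral (c := a) (by simp)).smul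
    (contDiff_const (c := Complex.I)).contDiffOn.absolutelyContinuousOnInterval
  convert! h1.add h2 using 1
  funext x
  apply Complex.ext
  · simpa using (Complex.reCLM.intervalIntegral_comp_comm (hii a x)).symm
  · simpa using (Complex.imCLM.intervalIntegral_comp_comm (hii a x)).symm

/-- Integration by parts of a continuously differentiable function against a primitive of a locally
integrable function. -/
theorem integral_deriv_mul_add_mul_eq_sub {g V h h' : ℝ → ℂ} (hg : LocallyIntegrable g)
    (hV : ∀ a b, V b - V a = ∫ y in a..b, g y) (hh : ∀ x, HasDerivAt h (h' x) x)
    (hh' : Continuous h') (a b : ℝ) :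
    ∫ x in a..b, (h' x * V x + h x * g x) = h b * V b - h a * V a := by
  have hii : ∀ a b, IntervalIntegrable g volume a b := fun a b =>
    (hg.integrableOn_isCompact isCompact_uIcc).intervalIntegrable
  have hVe : V = fun x => V a + ∫ y in a..x, g y := funext fun x => by rw [← hV]; ring
  have hVc : Continuous V := by
    rw [hVe]; exact continuous_const.add (intervalIntegral.continuous_primitive hii a)
  have hhc : Continuous h := continuous_iff_continuousAt.2 fun x => (hh x).continuousAt
  have hhs : ContDiff ℝ 1 h := by
    rw [contDiff_one_iff_deriv, funext fun x => (hh x).deriv]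
    exact ⟨fun x => (hh x).differentiableAt, hh'⟩
  have hF : LocallyIntegrable fun x => h' x * V x + h x * g x :=
    (hh'.mul hVc).locallyIntegrable.add (hg.continuous_smul hhc)
  have hVac : AbsolutelyContinuousOnInterval V a b := by
    rw [hVe]
    exact (contDiff_const (c := V a)).contDiffOn.absolutelyContinuousOnInterval.add
      (absolutelyContinuousOnInterval_primitive hg a b)
  -- The difference of `h V` and the primitive of the integrand has derivative zero only almost
  -- everywhere; absolute continuity is what makes it constant.
  have hac := (hhs.contDiffOn.absolutelyContinuousOnInterval.smul hVac).sub
    (absolutelyContinuousOnInterval_primitive hF a b)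
  obtain ⟨C, hC⟩ := hac.const_of_ae_hasDerivAt_zero (by
    filter_upwards [_root_.LocallyIntegrable.ae_hasDerivAt_integral hg,
      _root_.LocallyIntegrable.ae_hasDerivAt_integral hF] with x h1 h2 _
    have h3 : HasDerivAt V (g x) x := by rw [hVe]; exact (h1 a).const_add _
    have := ((hh x).mul h3).sub (h2 a)
    rw [sub_self] at this
    exact this)
  have e1 := hC a (by simp)
  have e2 := hC b (by simp)
  simp at e1 e2
  rw [e1, ← e2]; ring

/-- A continuous function, differentiable off one point with locally integrable derivative `g`,
has weak derivative `g`. -/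
theorem hasWeakDeriv_of_hasDerivAt {u g : ℝ → ℂ} (hu : Continuous u) (hg : LocallyIntegrable g)
    {y : ℝ} (hd : ∀ x, x ≠ y → HasDerivAt u (g x) x) : HasWeakDeriv u g := by
  intro φ hφ hs
  obtain ⟨R, hR0, hR⟩ : ∃ R : ℝ, 0 < R ∧ tsupport φ ⊆ Ioo (-R) R := by
    obtain ⟨r, hr⟩ := hs.isBounded.subset_ball 0
    refine ⟨max r 1, by positivity, hr.trans ?_⟩
    rw [Real.ball_eq_Ioo]
    apply Ioo_subset_Ioo <;> simp
  have h1 : ∀ x, x ∉ Ioo (-R) R → φ x = 0 := fun x hx =>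
    image_eq_zero_of_notMem_tsupport fun h => hx (hR h)
  have hle : -R ≤ R := by linarith
  have hd0 : Continuous (deriv φ) := hφ.continuous_deriv (by simp)
  have i1 := hu.locallyIntegrable (μ := volume) |>.integrable_smul_left_of_hasCompactSupport hd0 hs.deriv
  have i2 := hg.integrable_smul_left_of_hasCompactSupport hφ.continuous hs
  rw [eq_neg_iff_add_eq_zero, ← integral_add i1 i2]
  have e : ∫ x in (-R)..R, (deriv φ x • u x + φ x • g x) = φ R • u R - φ (-R) • u (-R) := by
    -- This form of the fundamental theorem tolerates a countable exceptional set, here the kink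
    -- `y`.
    refine integral_eq_of_hasDerivAt_off_countable_of_le (fun x => φ x • u x) _ hle
      (countable_singleton y) (hφ.continuous.smul hu).continuousOn ?_ ?_
    · intro x hx
      rw [add_comm]
      exact ((hφ.differentiable (by simp)).differentiableAt.hasDerivAt).smul (hd x hx.2)
    · exact (i1.add i2).intervalIntegrable
  rw [h1 R (by simp), h1 (-R) (by simp)] at e
  rw [intervalIntegral.integral_of_le hle, setIntegral_eq_integral_of_forall_compl_eq_zero] at e
  · simpa using e
  · intro x hx
    have hx' : x ∉ Ioo (-R) R := fun h => hx (Ioo_subset_Ioc_self h)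
    have h2 : deriv φ x = 0 := image_eq_zero_of_notMem_tsupport fun h =>
      hx' (hR (tsupport_deriv_subset h))
    simp [h1 x hx', h2]

/-! ### Constructing and conjugating elements of `H1`. -/

theorem HasWeakDeriv.congr_ae {u g u' g' : ℝ → ℂ} (h : HasWeakDeriv u g) (hu : u =ᵐ[volume] u')
    (hg : g =ᵐ[volume] g') : HasWeakDeriv u' g' := by
  intro φ hφ hφc
  rw [← integral_congr_ae (hu.mono fun x hx => congrArg (deriv φ x • ·) hx),
    ← integral_congr_ae (hg.mono fun x hx => congrArg (φ x • ·) hx)]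
  exact h φ hφ hφc

theorem L2.norm_sq_eq_integral (f : L2) : ‖f‖ ^ 2 = ∫ x, ‖f x‖ ^ 2 := by
  have h := inner_self_eq_norm_sq_to_K (𝕜 := ℂ) f
  rw [L2.inner_def] at h
  simp only [inner_self_eq_norm_sq_to_K] at h
  have e : ∫ x, ((‖f x‖ : ℂ)) ^ 2 = ((∫ x, ‖f x‖ ^ 2 : ℝ) : ℂ) := by
    rw [← integral_complex_ofReal]; simp
  apply Complex.ofReal_injective
  rw [← e]
  simpa using h.symm

theorem L2.norm_star (f : L2) : ‖star f‖ = ‖f‖ := by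
  rw [← sq_eq_sq₀ (norm_nonneg _) (norm_nonneg _), L2.norm_sq_eq_integral, L2.norm_sq_eq_integral]
  exact integral_congr_ae ((Lp.coeFn_star f).mono fun x hx => by simp [hx])

namespace H1

/-- The element of `H¹` given by a square integrable function and its square integrable weak
derivative. -/
def ofMemLp {u g : ℝ → ℂ} (hu : MemLp u 2) (hg : MemLp g 2) (h : HasWeakDeriv u g) : H1 :=
  ⟨WithLp.toLp 2 (hu.toLp u, hg.toLp g),
    h.congr_ae hu.coeFn_toLp.symm hg.coeFn_toLp.symm⟩

theorem toL2_ofMemLp {u g : ℝ → ℂ} (hu : MemLp u 2) (hg : MemLp g 2) (h : HasWeakDeriv u g) :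
    toL2 (ofMemLp hu hg h) =ᵐ[volume] u := hu.coeFn_toLp

theorem derivL2_ofMemLp {u g : ℝ → ℂ} (hu : MemLp u 2) (hg : MemLp g 2) (h : HasWeakDeriv u g) :
    derivL2 (ofMemLp hu hg h) =ᵐ[volume] g := hg.coeFn_toLp

theorem norm_sq_eq (u : H1) : ‖u‖ ^ 2 = ‖toL2 u‖ ^ 2 + ‖derivL2 u‖ ^ 2 :=
  WithLp.prod_norm_sq_eq_of_L2 (u : WithLp 2 (L2 × L2))

/-- The pairings are bilinear while Hilbert space arguments need the sesquilinear inner product;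
testing against a conjugate passes between them. The derivative is tracked too, so that the
Dirichlet form and the norm transform along. -/
theorem exists_conj_deriv (u : H1) :
    ∃ v : H1, toL2 v = star (toL2 u) ∧ derivL2 v = star (derivL2 u) := by
  refine ⟨⟨WithLp.toLp 2 (star (toL2 u), star (derivL2 u)), ?_⟩, rfl, rfl⟩
  intro φ hφ hφc
  have e : ∀ ψ : ℝ → ℝ, ∀ f : L2, ∫ x, ψ x • (star f : L2) x = star (∫ x, ψ x • f x) := by
    intro ψ f
    rw [show ∀ z : ℂ, star z = (starRingEnd ℂ) z from fun _ => rfl, ← integral_conj]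
    refine integral_congr_ae ((Lp.coeFn_star f).mono fun x hx => ?_)
    simp only [hx, Pi.star_apply, Complex.real_smul, map_mul, Complex.conj_ofReal]
    rfl
  have h := u.2 φ hφ hφc
  change ∫ x, deriv φ x • (star (toL2 u) : L2) x = -∫ x, φ x • (star (derivL2 u) : L2) x
  rw [e, e, ← star_neg]
  exact congrArg star h

/-- Complex conjugation on `H¹`. -/
def conj (u : H1) : H1 := (exists_conj_deriv u).choose

theorem toL2_conj (u : H1) : toL2 (conj u) = star (toL2 u) := (exists_conj_deriv u).choose_spec.1
theorem derivL2_conj (u : H1) : derivL2 (conj u) = star (derivL2 u) :=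
  (exists_conj_deriv u).choose_spec.2

theorem norm_conj (u : H1) : ‖conj u‖ = ‖u‖ := by
  have h := norm_sq_eq (conj u)
  rw [toL2_conj, derivL2_conj, L2.norm_star, L2.norm_star, ← norm_sq_eq] at h
  exact (sq_eq_sq₀ (norm_nonneg _) (norm_nonneg _)).1 h

end H1

theorem L2.integral_mul_star (f g : L2) : ∫ x, f x * (star g : L2) x = inner ℂ g f := by
  rw [L2.inner_def]
  refine integral_congr_ae ((Lp.coeFn_star g).mono fun x hx => ?_)
  simp only [hx, Pi.star_apply, RCLike.inner_apply]
  rfl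

theorem toHneg1_conj (u v : H1) :
    H1.toHneg1 u (H1.conj v) = inner ℂ (H1.toL2 v) (H1.toL2 u) := by
  rw [H1.toHneg1_apply, H1.toL2_conj, L2.integral_mul_star]

theorem dirichletForm_conj (u v : H1) :
    dirichletForm u (H1.conj v) = inner ℂ (H1.derivL2 v) (H1.derivL2 u) := by
  rw [dirichletForm_apply, H1.derivL2_conj, L2.integral_mul_star]

theorem toHneg1_comm (u v : H1) : H1.toHneg1 u v = H1.toHneg1 v u := by
  simp only [H1.toHneg1_apply, mul_comm]

theorem dirichletForm_comm (u v : H1) : dirichletForm u v = dirichletForm v u := by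
  simp only [dirichletForm_apply, mul_comm]

/-! ### The function `x ↦ exp (-μ |x - y|)` -/

/-- The function `x ↦ exp (-μ |x - y|)`. -/
def expAbs (μ : ℂ) (y x : ℝ) : ℂ := Complex.exp (-(μ * (|x - y| : ℝ)))

/-- The derivative off `y` of `x ↦ exp (-μ |x - y|)`. -/
def expAbsDeriv (μ : ℂ) (y x : ℝ) : ℂ := (if y < x then -μ else μ) * expAbs μ y x

theorem norm_expAbs (μ : ℂ) (y x : ℝ) : ‖expAbs μ y x‖ = Real.exp (-(μ.re * |x - y|)) := by
  rw [expAbs, Complex.norm_exp]; simp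

theorem norm_expAbsDeriv (μ : ℂ) (y x : ℝ) : ‖expAbsDeriv μ y x‖ = ‖μ‖ * ‖expAbs μ y x‖ := by
  rw [expAbsDeriv, norm_mul]; split_ifs <;> simp

theorem continuous_expAbs (μ : ℂ) (y : ℝ) : Continuous (expAbs μ y) := by
  unfold expAbs; fun_prop

theorem measurable_expAbsDeriv (μ : ℂ) (y : ℝ) : Measurable (expAbsDeriv μ y) :=
  (Measurable.ite measurableSet_Ioi measurable_const measurable_const).mul
    (continuous_expAbs μ y).measurable

theorem expAbs_of_le {μ : ℂ} {y x : ℝ} (h : y ≤ x) :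
    expAbs μ y x = Complex.exp (-(μ * (x - y))) := by
  rw [expAbs, abs_of_nonneg (by linarith)]; simp

theorem expAbs_of_ge {μ : ℂ} {y x : ℝ} (h : x ≤ y) :
    expAbs μ y x = Complex.exp (μ * (x - y)) := by
  rw [expAbs, abs_of_nonpos (by linarith)]; congr 1; push_cast; ring

theorem hasDerivAt_exp_mul_sub (c : ℂ) (y x : ℝ) :
    HasDerivAt (fun x : ℝ => Complex.exp (c * (x - y))) (c * Complex.exp (c * (x - y))) x := by
  have h := (((hasDerivAt_id (x : ℂ)).sub_const (y : ℂ)).const_mul c).cexp.comp_ofReal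
  simpa [mul_comm] using h

theorem hasDerivAt_expAbs {μ : ℂ} {y x : ℝ} (h : x ≠ y) :
    HasDerivAt (expAbs μ y) (expAbsDeriv μ y x) x := by
  rcases lt_or_gt_of_ne h with h | h
  · have e : expAbs μ y =ᶠ[𝓝 x] fun x => Complex.exp (μ * (x - y)) := by
      filter_upwards [Iio_mem_nhds h] with z hz using expAbs_of_ge (le_of_lt hz)
    rw [expAbsDeriv, if_neg (not_lt.2 h.le), expAbs_of_ge h.le]
    exact (hasDerivAt_exp_mul_sub μ y x).congr_of_eventuallyEq e
  · have e : expAbs μ y =ᶠ[𝓝 x] fun x => Complex.exp (-μ * (x - y)) := by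
      filter_upwards [Ioi_mem_nhds h] with z hz
      rw [expAbs_of_le (le_of_lt hz), neg_mul]
    rw [expAbsDeriv, if_pos h, expAbs_of_le h.le, ← neg_mul]
    exact (hasDerivAt_exp_mul_sub (-μ) y x).congr_of_eventuallyEq e

theorem integral_norm_expAbs_sq {μ : ℂ} (hμ : 0 < μ.re) (y : ℝ) :
    ∫ x, ‖expAbs μ y x‖ ^ 2 = 1 / μ.re := by
  have h := integral_comp_abs (f := fun t => Real.exp (-(2 * μ.re) * t))
  rw [integral_exp_mul_Ioi (by linarith)] at h
  rw [← integral_sub_right_eq_self _ y] at h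
  have e : ∀ x, ‖expAbs μ y x‖ ^ 2 = Real.exp (-(2 * μ.re) * |x - y|) := fun x => by
    rw [norm_expAbs, ← Real.exp_nat_mul]; congr 1; push_cast; ring
  simp only [e]
  rw [h]
  simp
  field_simp

theorem memLp_expAbs {μ : ℂ} (hμ : 0 < μ.re) (y : ℝ) : MemLp (expAbs μ y) 2 := by
  rw [memLp_two_iff_integrable_sq_norm (continuous_expAbs μ y).aestronglyMeasurable]
  -- A non-integrable function has integral `0` by convention, which contradicts the positive value
  -- `1 / μ.re`.
  by_contra h
  have h2 := integral_norm_expAbs_sq hμ y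
  rw [integral_undef h] at h2
  have : 0 < 1 / μ.re := by positivity
  linarith

theorem memLp_expAbsDeriv {μ : ℂ} (hμ : 0 < μ.re) (y : ℝ) : MemLp (expAbsDeriv μ y) 2 :=
  ((memLp_expAbs hμ y).const_mul μ).of_le (measurable_expAbsDeriv μ y).aestronglyMeasurable
    (ae_of_all _ fun x => by simp [norm_expAbsDeriv])

/-- The function `x ↦ exp (-μ |x - y|)` as an element of `H¹`, for `0 < re μ`. -/
def expH1 {μ : ℂ} (hμ : 0 < μ.re) (y : ℝ) : H1 :=
  H1.ofMemLp (memLp_expAbs hμ y) (memLp_expAbsDeriv hμ y)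
    (hasWeakDeriv_of_hasDerivAt (continuous_expAbs μ y)
      ((memLp_expAbsDeriv hμ y).locallyIntegrable (by norm_num)) fun _ => hasDerivAt_expAbs)

theorem toL2_expH1 {μ : ℂ} (hμ : 0 < μ.re) (y : ℝ) : H1.toL2 (expH1 hμ y) =ᵐ[volume] expAbs μ y :=
  H1.toL2_ofMemLp _ _ _

theorem derivL2_expH1 {μ : ℂ} (hμ : 0 < μ.re) (y : ℝ) :
    H1.derivL2 (expH1 hμ y) =ᵐ[volume] expAbsDeriv μ y := H1.derivL2_ofMemLp _ _ _

theorem eval_expH1 {μ : ℂ} (hμ : 0 < μ.re) (y x : ℝ) : H1.eval x (expH1 hμ y) = expAbs μ y x :=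
  (congrFun (H1.eq_rep (continuous_expAbs μ y) (toL2_expH1 hμ y).symm) x).symm

theorem norm_toL2_expH1_sq {μ : ℂ} (hμ : 0 < μ.re) (y : ℝ) :
    ‖H1.toL2 (expH1 hμ y)‖ ^ 2 = 1 / μ.re := by
  rw [L2.norm_sq_eq_integral, ← integral_norm_expAbs_sq hμ y]
  exact integral_congr_ae ((toL2_expH1 hμ y).mono fun x hx => by simp only [hx])

theorem norm_derivL2_expH1_sq {μ : ℂ} (hμ : 0 < μ.re) (y : ℝ) :
    ‖H1.derivL2 (expH1 hμ y)‖ ^ 2 = ‖μ‖ ^ 2 / μ.re := by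
  rw [L2.norm_sq_eq_integral, div_eq_mul_one_div, ← integral_norm_expAbs_sq hμ y,
    ← integral_const_mul]
  exact integral_congr_ae ((derivL2_expH1 hμ y).mono fun x hx => by
    simp only [hx, norm_expAbsDeriv, mul_pow])

/-- Kills the boundary terms at infinity: the continuous representative is bounded and the
exponential decays. -/
theorem tendsto_exp_mul_rep {c : ℂ} {l : Filter ℝ} (v : H1) (y : ℝ)
    (h : Tendsto (fun x : ℝ => c.re * (x - y)) l atBot) :
    Tendsto (fun x : ℝ => Complex.exp (c * (x - y)) * H1.rep v x) l (𝓝 0) := by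
  have h1 := (Real.tendsto_exp_atBot.comp h).mul_const (2 * ‖v‖)
  rw [zero_mul] at h1
  refine squeeze_zero_norm (fun x => ?_) h1
  rw [norm_mul, Complex.norm_exp]
  have : (c * ((x : ℂ) - y)).re = c.re * (x - y) := by simp
  rw [this]
  exact mul_le_mul_of_nonneg_left (H1.norm_rep_le v x) (Real.exp_pos _).le

/-- `exp (-μ |x - y|)` is `2μ` times the fundamental solution of `-∂² + μ²` at `y`. -/
theorem dirichletForm_expH1 {μ : ℂ} (hμ : 0 < μ.re) (y : ℝ) (v : H1) :
    dirichletForm (expH1 hμ y) v + μ ^ 2 * H1.toHneg1 (expH1 hμ y) v = 2 * μ * H1.eval y v := by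
  set V := H1.rep v with hV
  set g : ℝ → ℂ := fun x => H1.derivL2 v x with hg
  have hgl : LocallyIntegrable g := L2.locallyIntegrable _
  have hVL : MemLp V 2 := (Lp.memLp (H1.toL2 v)).ae_eq (H1.rep_ae_eq v).symm
  have i1 : Integrable fun x => expAbsDeriv μ y x * g x :=
    (memLp_expAbsDeriv hμ y).integrable_mul (Lp.memLp (H1.derivL2 v))
  have i2 : Integrable fun x => expAbs μ y x * V x := (memLp_expAbs hμ y).integrable_mul hVL
  set F : ℝ → ℂ := fun x => expAbsDeriv μ y x * g x + μ ^ 2 * (expAbs μ y x * V x) with hF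
  have iF : Integrable F := i1.add (i2.const_mul _)
  have e0 : dirichletForm (expH1 hμ y) v + μ ^ 2 * H1.toHneg1 (expH1 hμ y) v = ∫ x, F x := by
    rw [hF, integral_add i1 (i2.const_mul _), integral_const_mul, dirichletForm_apply,
      H1.toHneg1_apply]
    congr 1
    · exact integral_congr_ae ((derivL2_expH1 hμ y).mono fun x hx => by simp only [hx, hg])
    · congr 1
      refine integral_congr_ae ?_
      filter_upwards [toL2_expH1 hμ y, H1.rep_ae_eq v] with x h1 h2
      simp only [h1, hV, h2]
  have ibp := fun c : ℂ => integral_deriv_mul_add_mul_eq_sub hgl (H1.rep_sub v)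
    (hasDerivAt_exp_mul_sub c y) (by fun_prop)
  -- To the right of `y` the integrand is `-μ` times the total derivative of `exp (-μ (x - y)) V`,
  -- to the left it is `μ` times that of `exp (μ (x - y)) V`. Each side contributes `μ V y`.
  have eR : ∫ x in Ioi y, F x = μ * V y := by
    have t1 := intervalIntegral_tendsto_integral_Ioi y iF.integrableOn tendsto_id
    refine tendsto_nhds_unique t1 ?_
    have t2 := (tendsto_exp_mul_rep (c := -μ) (l := atTop) v y
      ((tendsto_atTop_add_const_right _ (-y) tendsto_id).const_mul_atTop_of_neg
        (by simpa using hμ))).const_mul (-μ)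
    have t3 := t2.add_const (μ * V y)
    rw [mul_zero, zero_add] at t3
    refine t3.congr' ?_
    filter_upwards [eventually_ge_atTop y] with b hb
    have := ibp (-μ) y b
    have e : ∫ x in y..b, F x = ∫ x in y..b, (-μ) * (-μ * Complex.exp (-μ * (x - y)) * H1.rep v x +
        Complex.exp (-μ * (x - y)) * (H1.derivL2 v) x) := by
      rw [intervalIntegral.integral_of_le hb, intervalIntegral.integral_of_le hb]
      refine setIntegral_congr_fun measurableSet_Ioc fun x hx => ?_
      simp only [hF, expAbsDeriv, if_pos hx.1, expAbs_of_le hx.1.le, neg_mul, hg, hV]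
      ring
    rw [id, e, intervalIntegral.integral_const_mul, this]
    simp [hV]; ring
  have eL : ∫ x in Iic y, F x = μ * V y := by
    have t1 := intervalIntegral_tendsto_integral_Iic y iF.integrableOn tendsto_id
    refine tendsto_nhds_unique t1 ?_
    have t2 := (tendsto_exp_mul_rep (c := μ) (l := atBot) v y
      ((tendsto_atBot_add_const_right _ (-y) tendsto_id).const_mul_atBot hμ)).const_mul (-μ)
    have t3 := t2.add_const (μ * V y)
    rw [mul_zero, zero_add] at t3
    refine t3.congr' ?_
    filter_upwards [eventually_le_atBot y] with b hb
    have := ibp μ b y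
    have e : ∫ x in b..y, F x = ∫ x in b..y, μ * (μ * Complex.exp (μ * (x - y)) * H1.rep v x +
        Complex.exp (μ * (x - y)) * (H1.derivL2 v) x) := by
      rw [intervalIntegral.integral_of_le hb, intervalIntegral.integral_of_le hb]
      refine setIntegral_congr_fun measurableSet_Ioc fun x hx => ?_
      simp only [hF, expAbsDeriv, if_neg (not_lt.2 hx.2), expAbs_of_ge hx.2, hg, hV]
      ring
    rw [id, e, intervalIntegral.integral_const_mul, this]
    simp [hV]; ring
  rw [e0, ← intervalIntegral.integral_Iic_add_Ioi iF.integrableOn iF.integrableOn, eR, eL]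
  change _ = 2 * μ * V y
  ring

/-! ### Completeness of `H1` and Lax–Milgram for the shifted Dirichlet form. -/

/-- For each fixed test function the defining identity equates two `L²`-continuous functionals. The
resulting completeness is needed for adjoints, the Riesz theorem and the open mapping theorem. -/
theorem H1.isClosed : IsClosed (H1 : Set (WithLp 2 (L2 × L2))) := by
  have key : ∀ ψ : ℝ → ℝ, Continuous ψ → HasCompactSupport ψ →
      Continuous fun f : L2 => ∫ x, ψ x • f x := by
    intro ψ h1 h2
    have hm : MemLp (fun x => (ψ x : ℂ)) 2 :=
      (Complex.continuous_ofReal.comp h1).memLp_of_hasCompactSupport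
        (h2.comp_left (g := ((↑) : ℝ → ℂ)) Complex.ofReal_zero)
    refine (L2.pairing (hm.toLp _)).continuous.congr fun f => ?_
    rw [L2.pairing, ContinuousLinearMap.lpPairing_eq_integral]
    refine integral_congr_ae (hm.coeFn_toLp.mono fun x hx => ?_)
    simp [hx]
  have e : (H1 : Set (WithLp 2 (L2 × L2))) = ⋂ (φ : ℝ → ℝ) (_ : ContDiff ℝ ∞ φ)
      (_ : HasCompactSupport φ), {p | ∫ x, deriv φ x • p.fst x = -∫ x, φ x • p.snd x} := by
    ext p
    simp only [mem_iInter]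
    exact Iff.rfl
  rw [e]
  refine isClosed_iInter fun φ => isClosed_iInter fun hφ => isClosed_iInter fun hφc => ?_
  exact isClosed_eq
    ((key _ (hφ.continuous_deriv (by simp)) hφc.deriv).comp (WithLp.fstL 2 ℂ L2 L2).continuous)
    ((key _ hφ.continuous hφc).comp (WithLp.sndL 2 ℂ L2 L2).continuous).neg

instance : CompleteSpace H1 := H1.isClosed.completeSpace_coe

theorem H1.conj_conj (u : H1) : conj (conj u) = u := by
  apply toL2_injective
  rw [toL2_conj, toL2_conj, star_star]

theorem H1.inner_eq (u v : H1) :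
    inner ℂ u v = inner ℂ (toL2 u) (toL2 v) + inner ℂ (derivL2 u) (derivL2 v) :=
  WithLp.prod_inner_apply (u : WithLp 2 (L2 × L2)) v

theorem H1.inner_eq_conj (u v : H1) :
    inner ℂ u v = toHneg1 v (conj u) + dirichletForm v (conj u) := by
  rw [inner_eq, toHneg1_conj, dirichletForm_conj]

theorem H1.inner_conj_comm (u v : H1) : inner ℂ u (conj v) = (inner ℂ v (conj u) : ℂ) := by
  rw [inner_eq_conj, inner_eq_conj, toHneg1_comm, dirichletForm_comm]

theorem norm_toHneg1_apply_le (u v : H1) :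
    ‖H1.toHneg1 u v‖ ≤ ‖H1.toL2 u‖ * ‖H1.toL2 v‖ := by
  rw [← H1.conj_conj v, toHneg1_conj, H1.toL2_conj (H1.conj v), L2.norm_star, mul_comm]
  exact norm_inner_le_norm _ _

/-- The shifted operator `z + A`, as a bounded operator from `H¹` to `H⁻¹`. -/
def shiftedForm (z : ℂ) : H1 →L[ℂ] Hneg1 := z • H1.toHneg1 + dirichletForm

theorem shiftedForm_apply (z : ℂ) (u v : H1) :
    shiftedForm z u v = z * H1.toHneg1 u v + dirichletForm u v := rfl

/-- Off the half-line `(-∞, 0]` the form `p + w q` is coercive on pairs of nonnegative numbers. -/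
theorem exists_coercive_of_notMem {w : ℂ} (hw : w ∉ nonposReals) :
    ∃ c : ℝ, 0 < c ∧ ∀ p q : ℝ, 0 ≤ p → 0 ≤ q → c * (p + q) ≤ ‖(p : ℂ) + w * q‖ := by
  by_cases him : w.im = 0
  · have hre : 0 < w.re := by
      by_contra h
      exact hw ⟨not_lt.1 h, him⟩
    refine ⟨min 1 w.re, by positivity, fun p q hp hq => ?_⟩
    have h1 := Complex.re_le_norm ((p : ℂ) + w * q)
    simp at h1
    have h2 := mul_le_mul_of_nonneg_right (min_le_left 1 w.re) hp
    have h3 := mul_le_mul_of_nonneg_right (min_le_right 1 w.re) hq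
    linarith
  · have hpos : 0 < |w.im| := abs_pos.2 him
    have hN := norm_nonneg w
    -- With `t` the norm on the right, the bounds `|w.im| q ≤ t` and `p - ‖w‖ q ≤ t` combine to
    -- `|w.im| (p + q) ≤ (|w.im| + 1 + ‖w‖) t`.
    refine ⟨|w.im| / (|w.im| + 1 + ‖w‖), by positivity, fun p q hp hq => ?_⟩
    set t := ‖(p : ℂ) + w * q‖ with ht
    have h1 : |w.im| * q ≤ t := by
      have h := Complex.abs_im_le_norm ((p : ℂ) + w * q)
      simpa [abs_mul, abs_of_nonneg hq] using h
    have h2 : p - ‖w‖ * q ≤ t := by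
      have h := norm_sub_norm_le (p : ℂ) (-(w * q))
      simpa [abs_of_nonneg hp, abs_of_nonneg hq] using h
    rw [div_mul_eq_mul_div, div_le_iff₀ (by positivity)]
    nlinarith [mul_le_mul_of_nonneg_left h2 hpos.le, mul_le_mul_of_nonneg_left h1 hN]

/-- Lax–Milgram: `T` represents the form through the inner product, and coercivity is the scalar
estimate with `p = ‖u_x‖²`, `q = ‖u‖²` in `L²`. -/
theorem bijective_shiftedForm {z : ℂ} (hz : z ∉ nonposReals) :
    Function.Bijective (shiftedForm z) := by
  let T : H1 →L[ℂ] H1 := (ContinuousLinearMap.adjoint H1.derivL2) ∘L H1.derivL2 +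
    z • (ContinuousLinearMap.adjoint H1.toL2) ∘L H1.toL2
  have hT : ∀ u v : H1, inner ℂ v (T u) = shiftedForm z u (H1.conj v) := by
    intro u v
    rw [shiftedForm_apply, toHneg1_conj, dirichletForm_conj]
    simp only [T, _root_.add_apply, _root_.smul_apply,
      ContinuousLinearMap.comp_apply, inner_add_right, inner_smul_right,
      ContinuousLinearMap.adjoint_inner_right]
    ring
  obtain ⟨c, hc, hcc⟩ := exists_coercive_of_notMem hz
  have hu : IsUnit T := by
    refine ContinuousLinearMap.isUnit_of_forall_le_norm_inner_map T (c := ⟨c, hc.le⟩) hc fun u => ?_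
    rw [← norm_inner_symm, hT, shiftedForm_apply, toHneg1_conj, dirichletForm_conj,
      inner_self_eq_norm_sq_to_K, inner_self_eq_norm_sq_to_K, H1.norm_sq_eq]
    have h := hcc (‖H1.derivL2 u‖ ^ 2) (‖H1.toL2 u‖ ^ 2) (by positivity) (by positivity)
    push_cast at h
    rw [add_comm (z * _), mul_comm, add_comm (‖H1.toL2 u‖ ^ 2)]
    exact h
  have hb := (ContinuousLinearMap.isUnit_iff_bijective).1 hu
  constructor
  · rw [injective_iff_map_eq_zero]
    intro u h0
    apply (injective_iff_map_eq_zero T).1 hb.1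
    rw [← inner_self_eq_zero (𝕜 := ℂ), hT, h0]
    rfl
  · intro f
    -- The form evaluates on `conj v` when `T` is paired with `v`, so the Riesz representative of
    -- `f` has to be conjugated.
    obtain ⟨u, hu⟩ := hb.2 (H1.conj ((InnerProductSpace.toDual ℂ H1).symm f))
    refine ⟨u, ?_⟩
    ext v
    rw [← H1.conj_conj v, ← hT, hu, H1.inner_conj_comm, InnerProductSpace.toDual_symm_apply]

/-! ### From the unbounded operator in `H⁻¹` to the bounded pencil on `H1`. -/

/-- The operator `z + A_β` as a bounded operator from `H¹` to `H⁻¹`. -/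
def pencil (x₀ β : ℝ) (z : ℂ) : H1 →L[ℂ] Hneg1 :=
  shiftedForm z + (β : ℂ) • (H1.eval x₀).smulRight (H1.eval 0)

theorem pencil_apply (x₀ β : ℝ) (z : ℂ) (u : H1) :
    pencil x₀ β z u = shiftedForm z u + ((β : ℂ) * H1.eval x₀ u) • H1.eval 0 := by
  rw [mul_smul]
  rfl

theorem smul_sub_neg_opA_apply (x₀ β : ℝ) (z : ℂ) (u : H1) :
    z • H1.toHneg1 u - (-opA x₀ β) ⟨H1.toHneg1 u, ⟨u, rfl⟩⟩ = pencil x₀ β z u := by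
  have h : (-opA x₀ β) ⟨H1.toHneg1 u, ⟨u, rfl⟩⟩ = -(opA x₀ β ⟨H1.toHneg1 u, ⟨u, rfl⟩⟩) := rfl
  rw [h, opA_apply, pencil_apply, sub_neg_eq_add, ← add_assoc]
  rfl

theorem mem_pointSpec_iff {x₀ β : ℝ} {z : ℂ} :
    z ∈ pointSpec (-opA x₀ β) ↔ ∃ u : H1, u ≠ 0 ∧ pencil x₀ β z u = 0 := by
  constructor
  · rintro ⟨⟨_, u, rfl⟩, h0, h⟩
    refine ⟨u, fun h1 => h0 (by subst h1; ext; simp), ?_⟩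
    rw [← smul_sub_neg_opA_apply]
    exact sub_eq_zero.2 h.symm
  · rintro ⟨u, h0, h⟩
    refine ⟨⟨H1.toHneg1 u, u, rfl⟩, fun h1 => h0 ?_, ?_⟩
    · apply (injective_iff_map_eq_zero _).1 H1.toHneg1_injective
      exact congrArg Subtype.val h1
    · rw [← smul_sub_neg_opA_apply] at h
      exact (sub_eq_zero.1 h).symm

theorem injective_smul_sub_iff {x₀ β : ℝ} {z : ℂ} :
    Function.Injective (fun u : (-opA x₀ β).domain => z • (u : Hneg1) - (-opA x₀ β) u) ↔
      Function.Injective (pencil x₀ β z) := by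
  constructor
  · intro h u v huv
    apply H1.toHneg1_injective
    have := @h ⟨H1.toHneg1 u, u, rfl⟩ ⟨H1.toHneg1 v, v, rfl⟩ (by
      simp only [smul_sub_neg_opA_apply, huv])
    exact congrArg Subtype.val this
  · rintro h ⟨_, u, rfl⟩ ⟨_, v, rfl⟩ huv
    have : u = v := h (by
      rw [← smul_sub_neg_opA_apply, ← smul_sub_neg_opA_apply]; exact huv)
    subst this
    rfl

theorem range_smul_sub (x₀ β : ℝ) (z : ℂ) :
    range (fun u : (-opA x₀ β).domain => z • (u : Hneg1) - (-opA x₀ β) u) =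
      range (pencil x₀ β z) := by
  ext f
  constructor
  · rintro ⟨⟨_, u, rfl⟩, rfl⟩
    exact ⟨u, (smul_sub_neg_opA_apply x₀ β z u).symm⟩
  · rintro ⟨u, rfl⟩
    exact ⟨⟨H1.toHneg1 u, u, rfl⟩, smul_sub_neg_opA_apply x₀ β z u⟩

theorem mem_resolventSet_of_bijective {x₀ β : ℝ} {z : ℂ}
    (h : Function.Bijective (pencil x₀ β z)) : z ∈ resolventSet (-opA x₀ β) := by
  -- The inverse is bounded by the open mapping theorem; followed by the inclusion of `H1` it is the
  -- resolvent.
  let E : H1 ≃L[ℂ] Hneg1 := ContinuousLinearEquiv.ofBijective (pencil x₀ β z)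
    (LinearMap.ker_eq_bot.2 h.1) (LinearMap.range_eq_top.2 h.2)
  have hE : ∀ u, E u = pencil x₀ β z u := fun u => rfl
  refine ⟨H1.toHneg1 ∘L (E.symm : Hneg1 →L[ℂ] H1), fun f => ?_, ?_⟩
  · refine ⟨⟨H1.toHneg1 (E.symm f), E.symm f, rfl⟩, rfl, ?_⟩
    rw [smul_sub_neg_opA_apply, ← hE, E.apply_symm_apply]
  · rintro ⟨_, u, rfl⟩
    change H1.toHneg1 (E.symm (z • H1.toHneg1 u - (-opA x₀ β) ⟨H1.toHneg1 u, u, rfl⟩)) = _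
    rw [smul_sub_neg_opA_apply, ← hE, E.symm_apply_apply]
    rfl

/-- The trace of the resolvent that is used later: an a priori bound, violated by kernel vectors and
by quasimodes alike. -/
theorem exists_norm_toHneg1_le_of_mem_resolventSet {x₀ β : ℝ} {z : ℂ}
    (h : z ∈ resolventSet (-opA x₀ β)) :
    ∃ C : ℝ, 0 ≤ C ∧ ∀ u : H1, ‖H1.toHneg1 u‖ ≤ C * ‖pencil x₀ β z u‖ := by
  obtain ⟨R, -, hR⟩ := h
  refine ⟨‖R‖, norm_nonneg _, fun u => ?_⟩
  have := hR ⟨H1.toHneg1 u, u, rfl⟩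
  rw [smul_sub_neg_opA_apply] at this
  have h2 := R.le_opNorm (pencil x₀ β z u)
  rwa [this] at h2

theorem injective_pencil_of_mem_resolventSet {x₀ β : ℝ} {z : ℂ}
    (h : z ∈ resolventSet (-opA x₀ β)) : Function.Injective (pencil x₀ β z) := by
  obtain ⟨C, -, hC⟩ := exists_norm_toHneg1_le_of_mem_resolventSet h
  rw [injective_iff_map_eq_zero]
  intro u hu
  have := hC u
  rw [hu, norm_zero, mul_zero] at this
  exact (injective_iff_map_eq_zero _).1 H1.toHneg1_injective u (norm_le_zero_iff.1 this)

/-! ### Off the half-line -/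

theorem shiftedForm_expH1 {μ : ℂ} (hμ : 0 < μ.re) (y : ℝ) :
    shiftedForm (μ ^ 2) (expH1 hμ y) = (2 * μ) • H1.eval y := by
  ext v
  rw [shiftedForm_apply, add_comm, dirichletForm_expH1]
  rfl

/-- The unperturbed part and the point term both produce multiples of `δ₀`, and the coefficients add
up to the characteristic function of the problem. -/
theorem pencil_expH1 {μ : ℂ} (hμ : 0 < μ.re) {x₀ : ℝ} (hx₀ : 0 < x₀) (β : ℝ) :
    pencil x₀ β (μ ^ 2) (expH1 hμ 0) =
      (2 * μ + β * Complex.exp (-(μ * x₀))) • H1.eval 0 := by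
  rw [pencil_apply, shiftedForm_expH1, eval_expH1, ← add_smul, expAbs_of_le hx₀.le]
  simp

theorem expH1_ne_zero {μ : ℂ} (hμ : 0 < μ.re) (y : ℝ) : expH1 hμ y ≠ 0 := by
  intro h
  have := norm_toL2_expH1_sq hμ y
  rw [h] at this
  simp at this
  linarith

theorem sq_notMem_nonposReals {μ : ℂ} (hμ : 0 < μ.re) : μ ^ 2 ∉ nonposReals := by
  rintro ⟨h1, h2⟩
  simp [pow_two] at h1 h2
  have : μ.im = 0 := by
    have : μ.re * μ.im = 0 := by linarith
    exact (mul_eq_zero.1 this).resolve_left hμ.ne'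
  rw [this] at h1
  nlinarith

theorem exists_sq_eq_of_notMem {z : ℂ} (hz : z ∉ nonposReals) : ∃ μ : ℂ, 0 < μ.re ∧ μ ^ 2 = z := by
  obtain ⟨μ, rfl⟩ : ∃ μ : ℂ, μ ^ 2 = z := 
    IsAlgClosed.exists_pow_nat_eq z two_pos
  rcases lt_trichotomy μ.re 0 with h | h | h
  · exact ⟨-μ, by simpa using h, by ring⟩
  · refine absurd ⟨?_, ?_⟩ hz
    · simp [pow_two, h]; nlinarith
    · simp [pow_two, h]
  · exact ⟨μ, h, rfl⟩

/-- Rank-one perturbation of an isomorphism: a kernel vector is a multiple of `expH1 hμ 0`, and an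
unperturbed solution is corrected by such a multiple. -/
theorem bijective_pencil {μ : ℂ} (hμ : 0 < μ.re) {x₀ : ℝ} (hx₀ : 0 < x₀) {β : ℝ}
    (h : 2 * μ + β * Complex.exp (-(μ * x₀)) ≠ 0) : Function.Bijective (pencil x₀ β (μ ^ 2)) := by
  have hb := bijective_shiftedForm (sq_notMem_nonposReals hμ)
  have hμ0 : μ ≠ 0 := by rintro rfl; simp at hμ
  constructor
  · rw [injective_iff_map_eq_zero]
    intro u hu
    have h1 : u = (-(β * H1.eval x₀ u) / (2 * μ)) • expH1 hμ 0 := by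
      apply hb.1
      rw [pencil_apply, ← eq_neg_iff_add_eq_zero] at hu
      rw [map_smul, shiftedForm_expH1, smul_smul, div_mul_cancel₀ _ (by simpa using hμ0), neg_smul, hu]
    rw [h1, map_smul, pencil_expH1 hμ hx₀, smul_smul] at hu
    -- `δ₀` takes the value `1` here, so its coefficient must vanish.
    have h2 := congrArg (fun f : Hneg1 => f (expH1 hμ 0)) hu
    simp only [_root_.smul_apply, eval_expH1, _root_.zero_apply,
      expAbs_of_le le_rfl] at h2
    simp [h, hμ0] at h2
    rw [h1]
    rcases h2 with h2 | h2 <;> simp [h2]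
  · intro f
    obtain ⟨u, hu⟩ := hb.2 f
    refine ⟨u - (β * H1.eval x₀ u / (2 * μ + β * Complex.exp (-(μ * x₀)))) • expH1 hμ 0, ?_⟩
    rw [map_sub, map_smul, pencil_expH1 hμ hx₀, smul_smul, div_mul_cancel₀ _ h, pencil_apply, hu]
    simp

/-! ### On the half-line -/

theorem exists_neg_sq_eq_of_mem {z : ℂ} (hz : z ∈ nonposReals) : ∃ s : ℝ, z = -(s : ℂ) ^ 2 := by
  refine ⟨√(-z.re), ?_⟩
  have h : √(-z.re) ^ 2 = -z.re := Real.sq_sqrt (by linarith [hz.1])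
  rw [← Complex.ofReal_pow, h]
  apply Complex.ext <;> simp [hz.2]

theorem norm_toL2_expH1 {μ : ℂ} (hμ : 0 < μ.re) (y : ℝ) :
    ‖H1.toL2 (expH1 hμ y)‖ = (√μ.re)⁻¹ := by
  rw [← Real.sqrt_inv, ← one_div, ← norm_toL2_expH1_sq hμ y, Real.sqrt_sq (norm_nonneg _)]

theorem add_mul_I_sq_add_sq (ε s : ℝ) :
    ((ε : ℂ) + s * Complex.I) ^ 2 + (s : ℂ) ^ 2 = ε * (ε + 2 * s * Complex.I) := by
  ring_nf; simp

/-- Limiting absorption: testing with `exp (-μ |x - y|)`, `μ = ε + i s`, leaves the error `(μ² + s²)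
∫ exp (-μ |x - y|) w`. The factor is `O(ε)` and the exponential has `L²` norm `ε ^ (-1/2)`, so the
error is `O(√ε)`. -/
theorem norm_eval_sub_le_of_shiftedForm_eq {s : ℝ} {w : H1} {c : ℂ} {p : ℝ}
    (h : ∀ v, shiftedForm (-(s : ℂ) ^ 2) w v = c * H1.eval p v) {ε : ℝ} (hε : 0 < ε) (y : ℝ) :
    ‖2 * (ε + s * Complex.I) * H1.eval y w - c * expAbs (ε + s * Complex.I) y p‖ ≤
      √ε * ‖(ε : ℂ) + 2 * s * Complex.I‖ * ‖w‖ := by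
  set μ : ℂ := ε + s * Complex.I with hμd
  have hre : μ.re = ε := by simp [hμd]
  have hμ : 0 < μ.re := by rwa [hre]
  have h1 := dirichletForm_expH1 hμ y w
  have h2 := h (expH1 hμ y)
  rw [eval_expH1, shiftedForm_apply, toHneg1_comm, dirichletForm_comm] at h2
  have h3 : 2 * μ * H1.eval y w - c * expAbs μ y p =
      ε * (ε + 2 * s * Complex.I) * H1.toHneg1 (expH1 hμ y) w := by
    rw [← add_mul_I_sq_add_sq, ← hμd]
    linear_combination h2 - h1
  have h4 := norm_toHneg1_apply_le (expH1 hμ y) w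
  have h5 : ‖H1.toL2 w‖ ≤ ‖w‖ := WithLp.norm_fst_le _ (w : WithLp 2 (L2 × L2))
  rw [norm_toL2_expH1, hre] at h4
  rw [h3, norm_mul, norm_mul, Complex.norm_real, Real.norm_of_nonneg hε.le]
  have h6 : ‖H1.toHneg1 (expH1 hμ y) w‖ ≤ (√ε)⁻¹ * ‖w‖ :=
    h4.trans (mul_le_mul_of_nonneg_left h5 (by positivity))
  calc _ ≤ ε * ‖(ε : ℂ) + 2 * s * Complex.I‖ * ((√ε)⁻¹ * ‖w‖) :=
        mul_le_mul_of_nonneg_left h6 (by positivity)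
    _ = _ := by
      have : ε * (√ε)⁻¹ = √ε := by rw [← div_eq_mul_inv, Real.div_sqrt]
      rw [show ∀ a b c d : ℝ, a * b * (c * d) = a * c * b * d from fun a b c d => by ring, this]

/-- A nonzero constant is not square integrable on the line. -/
theorem H1.eq_zero_of_norm_rep_eq_const {w : H1} {K : ℝ} (h : ∀ y, ‖rep w y‖ = K) : w = 0 := by
  have hm : MemLp (rep w) 2 := (Lp.memLp (toL2 w)).ae_eq (rep_ae_eq w).symm
  rw [memLp_two_iff_integrable_sq_norm (continuous_rep w).aestronglyMeasurable] at hm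
  simp only [h] at hm
  rw [integrable_const_iff] at hm
  have hK : K = 0 := by
    rcases hm with hm | hm
    · simpa using hm
    · exact absurd hm.measure_univ_lt_top (by simp)
  apply (injective_iff_map_eq_zero toL2).1 toL2_injective
  rw [Lp.eq_zero_iff_ae_eq_zero]
  refine (rep_ae_eq w).symm.trans (ae_of_all _ fun y => ?_)
  have := h y
  rw [hK] at this
  simpa using this

/-- There is no nonzero `H¹` solution of `-w'' - s² w = c δ_p`. -/
theorem eq_zero_of_shiftedForm_eq {s : ℝ} {w : H1} {c : ℂ} {p : ℝ}
    (h : ∀ v, shiftedForm (-(s : ℂ) ^ 2) w v = c * H1.eval p v) : w = 0 := by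
  have lim : ∀ y, 2 * (s * Complex.I) * H1.eval y w = c * expAbs (s * Complex.I) y p := by
    intro y
    rw [← sub_eq_zero]
    have hc : Continuous fun ε : ℝ =>
        2 * ((ε : ℂ) + s * Complex.I) * H1.eval y w - c * expAbs (ε + s * Complex.I) y p := by
      unfold expAbs; fun_prop
    have t1 := (hc.tendsto 0).mono_left (nhdsWithin_le_nhds (s := Ioi 0))
    have hb : Continuous fun ε : ℝ => √ε * ‖(ε : ℂ) + 2 * s * Complex.I‖ * ‖w‖ := by fun_prop
    have t2 := (hb.tendsto 0).mono_left (nhdsWithin_le_nhds (s := Ioi 0))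
    simp only [Real.sqrt_zero, zero_mul] at t2
    have t3 := squeeze_zero_norm' (by
      filter_upwards [self_mem_nhdsWithin] with ε hε
      exact norm_eval_sub_le_of_shiftedForm_eq h hε y) t2
    have := tendsto_nhds_unique t1 t3
    simpa using this
  by_cases hs : s = 0
  · subst hs
    have hc : c = 0 := by
      have := lim p
      simp [expAbs] at this
      exact this.symm
    -- For `s = 0` the limit identity has lost `w`; dividing the estimate by `2 ε` before the limit
    -- gives `‖w y‖ ≤ √ε ‖w‖ / 2`.
    refine H1.eq_zero_of_norm_rep_eq_const (K := 0) fun y => ?_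
    have hb : Continuous fun ε : ℝ => √ε * ‖w‖ / 2 := by fun_prop
    have t2 := (hb.tendsto 0).mono_left (nhdsWithin_le_nhds (s := Ioi 0))
    simp only [Real.sqrt_zero, zero_mul, zero_div] at t2
    refine le_antisymm (ge_of_tendsto t2 ?_) (norm_nonneg _)
    filter_upwards [self_mem_nhdsWithin] with ε (hε : 0 < ε)
    have := norm_eval_sub_le_of_shiftedForm_eq h hε y
    simp [hc, abs_of_pos hε] at this
    change ‖H1.eval y w‖ ≤ _
    change 2 * ε * ‖H1.eval y w‖ ≤ √ε * ε * ‖w‖ at this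
    rw [le_div_iff₀ two_pos]
    refine le_of_mul_le_mul_right ?_ hε
    linarith
  -- For `s ≠ 0` the limiting exponential has modulus one, so `2 |s| ‖w y‖ = ‖c‖` at every `y`.
  · refine H1.eq_zero_of_norm_rep_eq_const (K := ‖c‖ / (2 * |s|)) fun y => ?_
    have h1 := congrArg norm (lim y)
    rw [norm_mul, norm_mul, norm_mul, norm_mul, norm_expAbs] at h1
    simp at h1
    rw [eq_div_iff (by positivity), ← h1]
    change ‖H1.eval y w‖ * _ = _
    ring

theorem injective_pencil_of_mem_nonposReals {z : ℂ} (hz : z ∈ nonposReals) (x₀ β : ℝ) :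
    Function.Injective (pencil x₀ β z) := by
  obtain ⟨s, rfl⟩ := exists_neg_sq_eq_of_mem hz
  rw [injective_iff_map_eq_zero]
  intro u hu
  refine eq_zero_of_shiftedForm_eq (s := s) (c := -(β * H1.eval x₀ u)) (p := 0) fun v => ?_
  rw [pencil_apply, ← eq_neg_iff_add_eq_zero, ← neg_smul] at hu
  rw [hu]
  rfl

/-- The conjugate of a vector orthogonal to the range solves the transposed equation, in which `0`
and `x₀` are exchanged: the source is at `x₀`, with strength given by the value at `0`. Such a
solution vanishes. The isomorphism `shiftedForm 1` moves the range into the Hilbert space `H1`,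
where orthogonality decides density. -/
theorem denseRange_pencil_of_mem_nonposReals {z : ℂ} (hz : z ∈ nonposReals) (x₀ β : ℝ) :
    DenseRange (pencil x₀ β z) := by
  obtain ⟨s, rfl⟩ := exists_neg_sq_eq_of_mem hz
  have hb : Function.Bijective (shiftedForm 1) :=
    bijective_shiftedForm (fun h => by have := h.1; simp at this; linarith)
  let E : H1 ≃L[ℂ] Hneg1 := ContinuousLinearEquiv.ofBijective (shiftedForm 1)
    (LinearMap.ker_eq_bot.2 hb.1) (LinearMap.range_eq_top.2 hb.2)
  let Q : H1 →L[ℂ] H1 := (E.symm : Hneg1 →L[ℂ] H1) ∘L pencil x₀ β (-(s : ℂ) ^ 2)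
  have hQ : ∀ u, shiftedForm 1 (Q u) = pencil x₀ β (-(s : ℂ) ^ 2) u := fun u =>
    E.apply_symm_apply _
  have hd : DenseRange Q := by
    have h1 : (LinearMap.range (Q : H1 →ₗ[ℂ] H1)).topologicalClosure = ⊤ := by
      rw [Submodule.topologicalClosure_eq_top_iff, Submodule.eq_bot_iff]
      intro y hy
      have h0 : H1.conj y = 0 := by
        refine eq_zero_of_shiftedForm_eq (s := s) (c := -(β * H1.eval 0 (H1.conj y))) (p := x₀)
          fun u => ?_
        have h2 : inner ℂ y (Q u) = (0 : ℂ) := by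
          rw [← inner_conj_symm, hy (Q u) ⟨u, rfl⟩, map_zero]
        have h3 : inner ℂ y (Q u) = shiftedForm 1 (Q u) (H1.conj y) := by
          rw [H1.inner_eq_conj, shiftedForm_apply, one_mul]
        rw [h2, hQ, pencil_apply] at h3
        rw [shiftedForm_apply, toHneg1_comm, dirichletForm_comm, ← shiftedForm_apply]
        change 0 = shiftedForm (-(s : ℂ) ^ 2) u (H1.conj y) +
          (β * H1.eval x₀ u) * H1.eval 0 (H1.conj y) at h3
        linear_combination -h3
      rw [← norm_eq_zero, ← H1.norm_conj, h0, norm_zero]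
    rw [DenseRange, dense_iff_closure_eq]
    exact congrArg (fun K : Submodule ℂ H1 => (K : Set H1)) h1
  have h2 : DenseRange (E ∘ Q) := E.surjective.denseRange.comp hd E.continuous
  convert! h2 using 1
  funext u
  exact (hQ u).symm

/-- For the exponential `u` with `μ = ε + i s`, the pencil gives a bounded multiple of `δ₀` plus
`O(ε) u`, so a resolvent bound would keep `‖u‖` bounded in `H⁻¹` as `ε → 0`. But `1 / ε = ‖u‖²` in
`L²` is at most the product of the `H⁻¹` and `H1` norms, and the latter is only `O(ε ^ (-1/2))`. -/
theorem notMem_resolventSet_of_mem_nonposReals {z : ℂ} (hz : z ∈ nonposReals) {x₀ : ℝ}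
    (hx₀ : 0 < x₀) (β : ℝ) : z ∉ resolventSet (-opA x₀ β) := by
  intro hr
  obtain ⟨s, rfl⟩ := exists_neg_sq_eq_of_mem hz
  obtain ⟨C, hC0, hC⟩ := exists_norm_toHneg1_le_of_mem_resolventSet hr
  set m : ℝ := 1 + |s| with hm
  set K : ℝ := (2 * m + |β|) * ‖H1.eval 0‖ with hK
  have hm0 : 1 ≤ m := by simp [hm]
  have hK0 : 0 ≤ K := by positivity
  -- `a1` lets the term `O(ε) u` be absorbed on the left, `a2` contradicts the final inequality, and
  -- `a3` ensures `‖μ‖ ≤ m`.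
  have a1 : ∀ᶠ ε : ℝ in 𝓝[>] 0, C * (2 * m * ε) < 1 / 2 := by
    have hc : Continuous fun ε : ℝ => C * (2 * m * ε) := by fun_prop
    exact ((hc.tendsto 0).mono_left nhdsWithin_le_nhds).eventually_lt_const (by simp)
  have a2 : ∀ᶠ ε : ℝ in 𝓝[>] 0, ε * ((2 * C * K) ^ 2 * (1 + m ^ 2)) < 1 := by
    have hc : Continuous fun ε : ℝ => ε * ((2 * C * K) ^ 2 * (1 + m ^ 2)) := by fun_prop
    exact ((hc.tendsto 0).mono_left nhdsWithin_le_nhds).eventually_lt_const (by simp)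
  have a3 : ∀ᶠ ε : ℝ in 𝓝[>] 0, ε < 1 :=
    (tendsto_id.mono_left nhdsWithin_le_nhds).eventually_lt_const one_pos
  have a4 : ∀ᶠ ε : ℝ in 𝓝[>] 0, 0 < ε := self_mem_nhdsWithin
  obtain ⟨ε, h1, h2, h3, hε⟩ := (a1.and (a2.and (a3.and a4))).exists
  set μ : ℂ := ε + s * Complex.I with hμd
  have hre : μ.re = ε := by simp [hμd]
  have hμ : 0 < μ.re := by rwa [hre]
  have hμm : ‖μ‖ ≤ m := by
    refine (norm_add_le _ _).trans ?_
    simp [abs_of_pos hε]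
    linarith
  set u := expH1 hμ 0 with hu
  have e1 : pencil x₀ β (-(s : ℂ) ^ 2) u = (2 * μ + β * Complex.exp (-(μ * x₀))) • H1.eval 0 -
      ((ε : ℂ) * (ε + 2 * s * Complex.I)) • H1.toHneg1 u := by
    rw [← pencil_expH1 hμ hx₀, ← add_mul_I_sq_add_sq, ← hμd, pencil_apply, pencil_apply]
    ext v
    simp only [_root_.add_apply, _root_.sub_apply, _root_.smul_apply, shiftedForm_apply, smul_eq_mul]
    ring
  have e2 : ‖2 * μ + β * Complex.exp (-(μ * x₀))‖ ≤ 2 * m + |β| := by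
    refine (norm_add_le _ _).trans (add_le_add ?_ ?_)
    · rw [norm_mul]; simpa using hμm
    · rw [norm_mul, Complex.norm_exp, Complex.norm_real, Real.norm_eq_abs]
      refine mul_le_of_le_one_right (abs_nonneg _) (Real.exp_le_one_iff.2 ?_)
      simp [hre]
      positivity
  have e3 : ‖(ε : ℂ) * (ε + 2 * s * Complex.I)‖ ≤ 2 * m * ε := by
    rw [norm_mul, Complex.norm_real, Real.norm_of_nonneg hε.le, mul_comm]
    refine mul_le_mul_of_nonneg_right ((norm_add_le _ _).trans ?_) hε.le
    simp [abs_of_pos hε]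
    linarith [abs_nonneg s]
  have e4 : ‖H1.toHneg1 u‖ ≤ 2 * C * K := by
    have b1 : ‖pencil x₀ β (-(s : ℂ) ^ 2) u‖ ≤ K + 2 * m * ε * ‖H1.toHneg1 u‖ := by
      rw [e1]
      refine (norm_sub_le _ _).trans (add_le_add ?_ ?_)
      · rw [norm_smul]; exact mul_le_mul_of_nonneg_right e2 (norm_nonneg _)
      · rw [norm_smul]; exact mul_le_mul_of_nonneg_right e3 (norm_nonneg _)
    have b2 := (hC u).trans (mul_le_mul_of_nonneg_left b1 hC0)
    have b3 := mul_le_mul_of_nonneg_right h1.le (norm_nonneg (H1.toHneg1 u))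
    linarith
  -- The functional of `u` takes the value `‖u‖²` in `L²` at the conjugate of `u`.
  have e5 : 1 / ε ≤ ‖H1.toHneg1 u‖ * ‖u‖ := by
    have b1 := (H1.toHneg1 u).le_opNorm (H1.conj u)
    rw [toHneg1_conj, H1.norm_conj, inner_self_eq_norm_sq_to_K] at b1
    have b2 := norm_toL2_expH1_sq hμ 0
    rw [hre, ← hu] at b2
    rw [← b2]
    simpa using b1
  have e6 : ‖u‖ ^ 2 ≤ (1 + m ^ 2) / ε := by
    rw [H1.norm_sq_eq, hu, norm_toL2_expH1_sq, norm_derivL2_expH1_sq, hre, ← add_div]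
    have : ‖μ‖ ^ 2 ≤ m ^ 2 := pow_le_pow_left₀ (norm_nonneg _) hμm 2
    gcongr
  have e7 : (1 / ε) ^ 2 ≤ (2 * C * K) ^ 2 * ((1 + m ^ 2) / ε) := by
    calc (1 / ε) ^ 2 ≤ (‖H1.toHneg1 u‖ * ‖u‖) ^ 2 := pow_le_pow_left₀ (by positivity) e5 2
      _ = ‖H1.toHneg1 u‖ ^ 2 * ‖u‖ ^ 2 := by ring
      _ ≤ _ := mul_le_mul (pow_le_pow_left₀ (norm_nonneg _) e4 2) e6 (by positivity) (by positivity)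
  have e8 := mul_le_mul_of_nonneg_right e7 (sq_nonneg ε)
  have e9 : (1 / ε) ^ 2 * ε ^ 2 = 1 := by field_simp
  have e10 : (2 * C * K) ^ 2 * ((1 + m ^ 2) / ε) * ε ^ 2 =
      ε * ((2 * C * K) ^ 2 * (1 + m ^ 2)) := by field_simp
  rw [e9, e10] at e8
  linarith

/-! ### The spectrum -/

theorem mem_pointSpec_iff_exists {x₀ : ℝ} (hx₀ : 0 < x₀) {β : ℝ} {z : ℂ} :
    z ∈ pointSpec (-opA x₀ β) ↔
      ∃ μ : ℂ, 0 < μ.re ∧ μ ^ 2 = z ∧ 2 * μ + β * Complex.exp (-(μ * x₀)) = 0 := by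
  rw [mem_pointSpec_iff]
  constructor
  · rintro ⟨u, hu, h⟩
    have hz : z ∉ nonposReals := fun hz => hu
      ((injective_iff_map_eq_zero _).1 (injective_pencil_of_mem_nonposReals hz x₀ β) u h)
    obtain ⟨μ, hμ, rfl⟩ := exists_sq_eq_of_notMem hz
    refine ⟨μ, hμ, rfl, by_contra fun hne => hu ?_⟩
    exact (injective_iff_map_eq_zero _).1 (bijective_pencil hμ hx₀ hne).1 u h
  · rintro ⟨μ, hμ, rfl, h⟩
    refine ⟨expH1 hμ 0, expH1_ne_zero hμ 0, ?_⟩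
    rw [pencil_expH1 hμ hx₀, h, zero_smul]

theorem pointSpec_subset_spec (x₀ β : ℝ) : pointSpec (-opA x₀ β) ⊆ spec (-opA x₀ β) := by
  intro z hz hr
  obtain ⟨u, hu, h⟩ := mem_pointSpec_iff.1 hz
  exact hu ((injective_iff_map_eq_zero _).1 (injective_pencil_of_mem_resolventSet hr) u h)

theorem spec_neg_opA {x₀ : ℝ} (hx₀ : 0 < x₀) (β : ℝ) :
    spec (-opA x₀ β) = nonposReals ∪ pointSpec (-opA x₀ β) := by
  apply Subset.antisymm
  · intro z hz
    by_contra h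
    rw [mem_union, not_or] at h
    obtain ⟨μ, hμ, rfl⟩ := exists_sq_eq_of_notMem h.1
    refine hz (mem_resolventSet_of_bijective (bijective_pencil hμ hx₀ fun h0 => h.2 ?_))
    exact (mem_pointSpec_iff_exists hx₀).2 ⟨μ, hμ, rfl, h0⟩
  · exact union_subset (fun z hz => notMem_resolventSet_of_mem_nonposReals hz hx₀ β)
      (pointSpec_subset_spec x₀ β)

theorem contSpec_neg_opA {x₀ : ℝ} (hx₀ : 0 < x₀) (β : ℝ) :
    contSpec (-opA x₀ β) = nonposReals := by
  ext z
  simp only [contSpec, mem_ofPred_eq]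
  rw [injective_smul_sub_iff, DenseRange, range_smul_sub]
  constructor
  · rintro ⟨h1, h2, -⟩
    rw [spec_neg_opA hx₀] at h1
    refine h1.resolve_right fun h => ?_
    obtain ⟨u, hu, h⟩ := mem_pointSpec_iff.1 h
    exact hu ((injective_iff_map_eq_zero _).1 h2 u h)
  · intro hz
    exact ⟨notMem_resolventSet_of_mem_nonposReals hz hx₀ β,
      injective_pencil_of_mem_nonposReals hz x₀ β, denseRange_pencil_of_mem_nonposReals hz x₀ β⟩

/-! ### The curves traced by the eigenvalues

With `w = μ x₀ = ρ exp (iθ)`, the equation `2 μ + β exp (-μ x₀) = 0` reads `w exp w = -β x₀ / 2`. -/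

/-- The modulus of the solution with argument `θ` on the branch number `k`. -/
def branchRadius (k : ℕ) (θ : ℝ) : ℝ := ((2 * k + 1) * Real.pi - θ) / Real.sin θ

/-- The parameter for which the branch number `k` has a solution with argument `θ`. -/
def branchParam (x₀ : ℝ) (k : ℕ) (θ : ℝ) : ℝ :=
  2 / x₀ * (branchRadius k θ * Real.exp (branchRadius k θ * Real.cos θ))

/-- The argument of the solution on the branch number `k`, as a function of the parameter. -/
def branchAngle (x₀ : ℝ) (k : ℕ) (β : ℝ) : ℝ :=
  Function.invFunOn (branchParam x₀ k) (Ioo 0 (Real.pi / 2)) β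

/-- The solution with argument `θ` on the branch number `k`. -/
def branchRoot (x₀ : ℝ) (k : ℕ) (θ : ℝ) : ℂ :=
  (branchRadius k θ / x₀ : ℝ) * Complex.exp (θ * Complex.I)

/-- The eigenvalue on the branch number `k`, as a function of the parameter. -/
def branchEigenvalue (x₀ : ℝ) (k : ℕ) (β : ℝ) : ℂ := branchRoot x₀ k (branchAngle x₀ k β) ^ 2

theorem sin_pos_of_mem_Ioc {θ : ℝ} (h : θ ∈ Ioc 0 (Real.pi / 2)) : 0 < Real.sin θ :=
  Real.sin_pos_of_pos_of_lt_pi h.1 (by linarith [h.2, Real.pi_pos])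

theorem cos_nonneg_of_mem_Ioc {θ : ℝ} (h : θ ∈ Ioc 0 (Real.pi / 2)) : 0 ≤ Real.cos θ :=
  Real.cos_nonneg_of_mem_Icc ⟨by linarith [h.1, Real.pi_pos], h.2⟩

theorem half_pi_le_numerator {k : ℕ} {θ : ℝ} (h : θ ∈ Ioc 0 (Real.pi / 2)) :
    Real.pi / 2 ≤ (2 * k + 1) * Real.pi - θ := by
  have : 0 ≤ (k : ℝ) * Real.pi := by positivity
  nlinarith [h.2]

theorem branchRadius_pos {k : ℕ} {θ : ℝ} (h : θ ∈ Ioc 0 (Real.pi / 2)) : 0 < branchRadius k θ :=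
  div_pos (by linarith [half_pi_le_numerator (k := k) h, Real.pi_pos]) (sin_pos_of_mem_Ioc h)

theorem branchRadius_mul_sin {k : ℕ} {θ : ℝ} (h : θ ∈ Ioc 0 (Real.pi / 2)) :
    branchRadius k θ * Real.sin θ = (2 * k + 1) * Real.pi - θ :=
  div_mul_cancel₀ _ (sin_pos_of_mem_Ioc h).ne'

theorem strictAntiOn_branchRadius (k : ℕ) :
    StrictAntiOn (branchRadius k) (Ioc 0 (Real.pi / 2)) := by
  intro a ha b hb hab
  have hs : Real.sin a < Real.sin b :=
    Real.strictMonoOn_sin ⟨by linarith [ha.1, Real.pi_pos], ha.2⟩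
      ⟨by linarith [hb.1, Real.pi_pos], hb.2⟩ hab
  refine div_lt_div₀ (by linarith) hs.le ?_ (sin_pos_of_mem_Ioc ha)
  linarith [half_pi_le_numerator (k := k) ha, Real.pi_pos]

theorem strictMono_branchRadius {θ : ℝ} (h : θ ∈ Ioc 0 (Real.pi / 2)) :
    StrictMono fun k => branchRadius k θ := by
  intro j k hjk
  refine div_lt_div_of_pos_right ?_ (sin_pos_of_mem_Ioc h)
  have : (j : ℝ) < k := Nat.cast_lt.2 hjk
  nlinarith [Real.pi_pos]

/-- On the first quadrant both the radius and the cosine decrease in `θ`, hence so does `ρ exp (ρ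
cos θ)`. This makes `θ` a global coordinate on the branch. -/
theorem strictAntiOn_branchParam {x₀ : ℝ} (hx₀ : 0 < x₀) (k : ℕ) :
    StrictAntiOn (branchParam x₀ k) (Ioc 0 (Real.pi / 2)) := by
  intro a ha b hb hab
  have h1 := strictAntiOn_branchRadius k ha hb hab
  have h2 : Real.cos b ≤ Real.cos a :=
    Real.cos_le_cos_of_nonneg_of_le_pi ha.1.le (by linarith [hb.2, Real.pi_pos]) hab.le
  have h3 : branchRadius k b * Real.cos b ≤ branchRadius k a * Real.cos a :=
    mul_le_mul h1.le h2 (cos_nonneg_of_mem_Ioc hb) (branchRadius_pos ha).le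
  refine mul_lt_mul_of_pos_left ?_ (by positivity)
  exact mul_lt_mul h1 (Real.exp_le_exp.2 h3) (Real.exp_pos _) (branchRadius_pos ha).le

theorem strictMono_branchParam {x₀ : ℝ} (hx₀ : 0 < x₀) {θ : ℝ} (h : θ ∈ Ioc 0 (Real.pi / 2)) :
    StrictMono fun k => branchParam x₀ k θ := by
  intro j k hjk
  have h1 : branchRadius j θ < branchRadius k θ := strictMono_branchRadius h hjk
  have h3 : branchRadius j θ * Real.cos θ ≤ branchRadius k θ * Real.cos θ :=
    mul_le_mul_of_nonneg_right h1.le (cos_nonneg_of_mem_Ioc h)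
  refine mul_lt_mul_of_pos_left ?_ (by positivity)
  exact mul_lt_mul h1 (Real.exp_le_exp.2 h3) (Real.exp_pos _) (branchRadius_pos h).le

theorem continuousAt_branchRadius {k : ℕ} {θ : ℝ} (h : θ ∈ Ioc 0 (Real.pi / 2)) :
    ContinuousAt (branchRadius k) θ :=
  (by fun_prop : ContinuousAt (fun θ => (2 * k + 1) * Real.pi - θ) θ).div
    Real.continuous_sin.continuousAt (sin_pos_of_mem_Ioc h).ne'

theorem continuousAt_branchParam {x₀ : ℝ} {k : ℕ} {θ : ℝ} (h : θ ∈ Ioc 0 (Real.pi / 2)) :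
    ContinuousAt (branchParam x₀ k) θ := by
  have := continuousAt_branchRadius (k := k) h
  unfold branchParam
  fun_prop

theorem continuousAt_branchRoot {x₀ : ℝ} {k : ℕ} {θ : ℝ} (h : θ ∈ Ioc 0 (Real.pi / 2)) :
    ContinuousAt (branchRoot x₀ k) θ := by
  have h1 : ContinuousAt (fun θ => ((branchRadius k θ / x₀ : ℝ) : ℂ)) θ :=
    Complex.continuous_ofReal.continuousAt.comp ((continuousAt_branchRadius h).div_const x₀)
  exact h1.mul (by fun_prop)

theorem surjOn_branchParam {x₀ : ℝ} (hx₀ : 0 < x₀) (k : ℕ) :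
    SurjOn (branchParam x₀ k) (Ioo 0 (Real.pi / 2)) (Ioi (branchParam x₀ k (Real.pi / 2))) := by
  intro β (hβ : _ < β)
  have hpi := Real.pi_pos
  have hmem : Real.pi / 2 ∈ Ioc 0 (Real.pi / 2) := ⟨by positivity, le_rfl⟩
  have hβ0 : 0 < β := by
    refine lt_of_le_of_lt ?_ hβ
    have := branchRadius_pos (k := k) hmem
    unfold branchParam
    positivity
  -- Chosen so that `sin t ≤ π / (x₀ β)`; the numerator of the radius is at least `π / 2`, so the
  -- radius is at least `x₀ β / 2` and the parameter at least `β`.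
  set t := min (Real.pi / 2) (Real.pi / (x₀ * β)) with ht
  have htm : t ∈ Ioc 0 (Real.pi / 2) := ⟨by positivity, min_le_left _ _⟩
  have h1 : β ≤ branchParam x₀ k t := by
    have a1 : Real.sin t ≤ Real.pi / (x₀ * β) :=
      (Real.sin_le htm.1.le).trans (min_le_right _ _)
    have a2 : x₀ * β / 2 ≤ branchRadius k t := by
      rw [branchRadius, le_div_iff₀ (sin_pos_of_mem_Ioc htm)]
      refine le_trans ?_ (half_pi_le_numerator htm)
      calc x₀ * β / 2 * Real.sin t ≤ x₀ * β / 2 * (Real.pi / (x₀ * β)) := by gcongr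
        _ = Real.pi / 2 := by field_simp
    have a3 : 1 ≤ Real.exp (branchRadius k t * Real.cos t) :=
      Real.one_le_exp (mul_nonneg (branchRadius_pos htm).le (cos_nonneg_of_mem_Ioc htm))
    calc β = 2 / x₀ * (x₀ * β / 2 * 1) := by field_simp
      _ ≤ _ := by unfold branchParam; gcongr; exact (branchRadius_pos htm).le
  obtain ⟨θ, hθ, e⟩ := intermediate_value_Icc' htm.2 (f := branchParam x₀ k)
    (fun s hs => (continuousAt_branchParam
      ⟨htm.1.trans_le hs.1, hs.2⟩).continuousWithinAt) ⟨hβ.le, h1⟩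
  refine ⟨θ, ⟨htm.1.trans_le hθ.1, lt_of_le_of_ne hθ.2 ?_⟩, e⟩
  rintro rfl
  exact hβ.ne e

theorem branchAngle_mem {x₀ : ℝ} (hx₀ : 0 < x₀) {k : ℕ} {β : ℝ}
    (hβ : branchParam x₀ k (Real.pi / 2) < β) : branchAngle x₀ k β ∈ Ioo 0 (Real.pi / 2) :=
  Function.invFunOn_mem (surjOn_branchParam hx₀ k hβ)

theorem branchParam_branchAngle {x₀ : ℝ} (hx₀ : 0 < x₀) {k : ℕ} {β : ℝ}
    (hβ : branchParam x₀ k (Real.pi / 2) < β) : branchParam x₀ k (branchAngle x₀ k β) = β :=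
  Function.invFunOn_eq (surjOn_branchParam hx₀ k hβ)

theorem branchParam_half_pi_lt {x₀ : ℝ} (hx₀ : 0 < x₀) (k : ℕ) {θ : ℝ}
    (hθ : θ ∈ Ioo 0 (Real.pi / 2)) : branchParam x₀ k (Real.pi / 2) < branchParam x₀ k θ :=
  strictAntiOn_branchParam hx₀ k (Ioo_subset_Ioc_self hθ) ⟨by positivity, le_rfl⟩ hθ.2

theorem branchAngle_branchParam {x₀ : ℝ} (hx₀ : 0 < x₀) (k : ℕ) {θ : ℝ}
    (hθ : θ ∈ Ioo 0 (Real.pi / 2)) : branchAngle x₀ k (branchParam x₀ k θ) = θ := by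
  have h := branchParam_half_pi_lt hx₀ k hθ
  exact (strictAntiOn_branchParam hx₀ k).injOn (Ioo_subset_Ioc_self (branchAngle_mem hx₀ h))
    (Ioo_subset_Ioc_self hθ) (branchParam_branchAngle hx₀ h)

theorem branchAngle_lt_iff {x₀ : ℝ} (hx₀ : 0 < x₀) {k : ℕ} {β θ : ℝ}
    (hβ : branchParam x₀ k (Real.pi / 2) < β) (hθ : θ ∈ Ioc 0 (Real.pi / 2)) :
    branchAngle x₀ k β < θ ↔ branchParam x₀ k θ < β := by
  rw [← (strictAntiOn_branchParam hx₀ k).lt_iff_gt hθ (Ioo_subset_Ioc_self (branchAngle_mem hx₀ hβ)),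
    branchParam_branchAngle hx₀ hβ]

theorem lt_branchAngle_iff {x₀ : ℝ} (hx₀ : 0 < x₀) {k : ℕ} {β θ : ℝ}
    (hβ : branchParam x₀ k (Real.pi / 2) < β) (hθ : θ ∈ Ioc 0 (Real.pi / 2)) :
    θ < branchAngle x₀ k β ↔ β < branchParam x₀ k θ := by
  rw [← (strictAntiOn_branchParam hx₀ k).lt_iff_gt (Ioo_subset_Ioc_self (branchAngle_mem hx₀ hβ)) hθ,
    branchParam_branchAngle hx₀ hβ]

theorem strictAntiOn_branchAngle {x₀ : ℝ} (hx₀ : 0 < x₀) (k : ℕ) :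
    StrictAntiOn (branchAngle x₀ k) (Ioi (branchParam x₀ k (Real.pi / 2))) := by
  intro a ha b hb hab
  rw [branchAngle_lt_iff hx₀ hb (Ioo_subset_Ioc_self (branchAngle_mem hx₀ ha)),
    branchParam_branchAngle hx₀ ha]
  exact hab

theorem continuousAt_branchAngle {x₀ : ℝ} (hx₀ : 0 < x₀) {k : ℕ} {β : ℝ}
    (hβ : branchParam x₀ k (Real.pi / 2) < β) : ContinuousAt (branchAngle x₀ k) β := by
  -- A monotone function whose image is a neighbourhood of its value is continuous there; the sign
  -- makes the angle increasing, and every angle in `(0, π/2)` is attained.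
  have hmono : StrictMonoOn (fun β => -branchAngle x₀ k β)
      (Ioi (branchParam x₀ k (Real.pi / 2))) := fun a ha b hb hab =>
    neg_lt_neg (strictAntiOn_branchAngle hx₀ k ha hb hab)
  have h := branchAngle_mem hx₀ hβ
  have hc := hmono.continuousAt_of_image_mem_nhds (Ioi_mem_nhds hβ) (by
    refine mem_of_superset (Ioo_mem_nhds (neg_lt_neg h.2) (neg_lt_neg h.1)) fun t ht => ?_
    have ht' : -t ∈ Ioo 0 (Real.pi / 2) := ⟨by linarith [ht.2], by linarith [ht.1]⟩
    exact ⟨branchParam x₀ k (-t), branchParam_half_pi_lt hx₀ k ht', by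
      simp only [branchAngle_branchParam hx₀ k ht', neg_neg]⟩)
  convert! hc.neg using 1
  funext t
  simp

theorem tendsto_branchAngle_half_pi {x₀ : ℝ} (hx₀ : 0 < x₀) (k : ℕ) :
    Tendsto (branchAngle x₀ k) (𝓝[>] (branchParam x₀ k (Real.pi / 2))) (𝓝 (Real.pi / 2)) := by
  have hpi := Real.pi_pos
  rw [tendsto_order]
  constructor
  · intro a ha
    have hm : max a (Real.pi / 4) ∈ Ioo 0 (Real.pi / 2) :=
      ⟨lt_max_of_lt_right (by positivity), max_lt ha (by linarith)⟩
    filter_upwards [self_mem_nhdsWithin,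
      mem_nhdsWithin_of_mem_nhds (Iio_mem_nhds (branchParam_half_pi_lt hx₀ k hm))] with β h1 h2
    exact (le_max_left _ _).trans_lt
      ((lt_branchAngle_iff hx₀ h1 (Ioo_subset_Ioc_self hm)).2 h2)
  · intro a ha
    filter_upwards [self_mem_nhdsWithin] with β h1
    exact (branchAngle_mem hx₀ h1).2.trans ha

theorem tendsto_branchAngle_zero {x₀ : ℝ} (hx₀ : 0 < x₀) (k : ℕ) :
    Tendsto (branchAngle x₀ k) atTop (𝓝[>] 0) := by
  have hpi := Real.pi_pos
  refine tendsto_nhdsWithin_iff.2 ⟨tendsto_order.2 ⟨fun a ha => ?_, fun a ha => ?_⟩, ?_⟩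
  · filter_upwards [eventually_gt_atTop (branchParam x₀ k (Real.pi / 2))] with β h1
    exact ha.trans (branchAngle_mem hx₀ h1).1
  · have hm : min a (Real.pi / 2) ∈ Ioc 0 (Real.pi / 2) :=
      ⟨lt_min ha (by positivity), min_le_right _ _⟩
    filter_upwards [eventually_gt_atTop (branchParam x₀ k (Real.pi / 2)),
      eventually_gt_atTop (branchParam x₀ k (min a (Real.pi / 2)))] with β h1 h2
    exact ((branchAngle_lt_iff hx₀ h1 hm).2 h2).trans_le (min_le_left _ _)
  · filter_upwards [eventually_gt_atTop (branchParam x₀ k (Real.pi / 2))] with β h1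
    exact (branchAngle_mem hx₀ h1).1

/-! ### Roots of the characteristic equation -/

theorem branchRoot_sq (x₀ : ℝ) (k : ℕ) (θ : ℝ) :
    branchRoot x₀ k θ ^ 2 =
      ((branchRadius k θ / x₀) ^ 2 : ℝ) * Complex.exp ((2 * θ : ℝ) * Complex.I) := by
  rw [branchRoot, mul_pow, ← Complex.exp_nat_mul]
  push_cast
  ring_nf

theorem re_branchRoot (x₀ : ℝ) (k : ℕ) (θ : ℝ) :
    (branchRoot x₀ k θ).re = branchRadius k θ / x₀ * Real.cos θ := by
  rw [branchRoot, Complex.re_ofReal_mul, Complex.exp_ofReal_mul_I_re]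

theorem im_branchRoot (x₀ : ℝ) (k : ℕ) (θ : ℝ) :
    (branchRoot x₀ k θ).im = branchRadius k θ / x₀ * Real.sin θ := by
  rw [branchRoot, Complex.im_ofReal_mul, Complex.exp_ofReal_mul_I_im]

theorem re_branchRoot_pos {x₀ : ℝ} (hx₀ : 0 < x₀) (k : ℕ) {θ : ℝ} (hθ : θ ∈ Ioo 0 (Real.pi / 2)) :
    0 < (branchRoot x₀ k θ).re := by
  rw [re_branchRoot]
  exact mul_pos (div_pos (branchRadius_pos (Ioo_subset_Ioc_self hθ)) hx₀)
    (Real.cos_pos_of_mem_Ioo ⟨by linarith [hθ.1, Real.pi_pos], hθ.2⟩)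

/-- The choice of `ρ` gives `exp (-μ x₀)` the argument `θ - π` modulo `2π`, opposite to that of `μ`;
the choice of the parameter balances the moduli. -/
theorem branchRoot_isRoot {x₀ : ℝ} (hx₀ : 0 < x₀) (k : ℕ) {θ : ℝ} (hθ : θ ∈ Ioc 0 (Real.pi / 2)) :
    2 * branchRoot x₀ k θ +
      branchParam x₀ k θ * Complex.exp (-(branchRoot x₀ k θ * x₀)) = 0 := by
  have e1 : -(branchRoot x₀ k θ * x₀) = ((-(branchRadius k θ * Real.cos θ) : ℝ) : ℂ) +
      ((-(branchRadius k θ * Real.sin θ) : ℝ) : ℂ) * Complex.I := by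
    apply Complex.ext
    · simp [re_branchRoot]; field_simp; rw [Complex.cos_ofReal_re]
    · simp [im_branchRoot]; field_simp; rw [Complex.sin_ofReal_re]
  have e2 : ((-(branchRadius k θ * Real.sin θ) : ℝ) : ℂ) * Complex.I =
      θ * Complex.I - Real.pi * Complex.I - k * (2 * Real.pi * Complex.I) := by
    rw [branchRadius_mul_sin hθ]; push_cast; ring
  have e3 : Real.exp (branchRadius k θ * Real.cos θ) * Real.exp (-(branchRadius k θ * Real.cos θ)) =
      1 := by rw [← Real.exp_add, add_neg_cancel, Real.exp_zero]
  have e4 := congrArg ((↑) : ℝ → ℂ) e3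
  rw [e1, Complex.exp_add, e2, Complex.exp_sub, Complex.exp_nat_mul_two_pi_mul_I, Complex.exp_sub,
    Complex.exp_pi_mul_I, branchParam, branchRoot, ← Complex.ofReal_exp]
  push_cast at e4 ⊢
  linear_combination -(2 * (branchRadius k θ : ℂ) / x₀ * Complex.exp (θ * Complex.I)) * e4

/-- Taking arguments in the equation yields `θ + μ.im x₀ = π + 2πn`, which fixes the radius; taking
norms then recovers `β`. -/
theorem exists_branchRoot_eq {x₀ : ℝ} (hx₀ : 0 < x₀) {β : ℝ} (hβ : 0 ≤ β) {μ : ℂ}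
    (hre : 0 < μ.re) (him : 0 < μ.im) (h : 2 * μ + β * Complex.exp (-(μ * x₀)) = 0) :
    ∃ k, ∃ θ ∈ Ioo 0 (Real.pi / 2), branchParam x₀ k θ = β ∧ branchRoot x₀ k θ = μ := by
  set θ := Complex.arg μ with hθd
  have hθ : θ ∈ Ioo 0 (Real.pi / 2) := by
    constructor
    · have h1 : 0 ≤ θ := Complex.arg_nonneg_iff.2 him.le
      refine lt_of_le_of_ne h1 fun h0 => ?_
      have := (Complex.arg_eq_zero_iff.1 h0.symm).2
      linarith
    · have := Complex.abs_arg_lt_pi_div_two_iff.2 (Or.inl hre)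
      exact (le_abs_self _).trans_lt this
  have hn : 0 < ‖μ‖ := norm_pos_iff.2 fun h0 => by simp [h0] at hre
  have hμ : (‖μ‖ : ℂ) * Complex.exp (θ * Complex.I) = μ := Complex.norm_mul_exp_arg_mul_I μ
  have hμre : μ.re = ‖μ‖ * Real.cos θ := (Complex.norm_mul_cos_arg μ).symm
  have hμim : μ.im = ‖μ‖ * Real.sin θ := (Complex.norm_mul_sin_arg μ).symm
  have h1 : 2 * μ = -(β * Complex.exp (-(μ * x₀))) := eq_neg_of_add_eq_zero_left h
  have h2 : 2 * ‖μ‖ = β * Real.exp (-(μ.re * x₀)) := by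
    have := congrArg norm h1
    rw [norm_mul, norm_neg, norm_mul, Complex.norm_exp, Complex.norm_real,
      Real.norm_of_nonneg hβ] at this
    simpa using this
  have e1 : -(μ * x₀) = ((-(μ.re * x₀) : ℝ) : ℂ) + -(((μ.im * x₀ : ℝ) : ℂ) * Complex.I) := by
    apply Complex.ext <;> simp
  have h3 : Complex.exp (((θ + μ.im * x₀ : ℝ) : ℂ) * Complex.I) = Complex.exp (Real.pi * Complex.I) := by
    have a1 : 2 * (‖μ‖ : ℂ) * Complex.exp (θ * Complex.I) =
        -(2 * (‖μ‖ : ℂ) * Complex.exp (-(((μ.im * x₀ : ℝ) : ℂ) * Complex.I))) := by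
      rw [mul_assoc, hμ, h1, e1, Complex.exp_add, ← mul_assoc, ← Complex.ofReal_exp,
        ← Complex.ofReal_mul, ← h2]
      push_cast; rfl
    have hn' : (2 * (‖μ‖ : ℂ)) ≠ 0 := by simpa using hn.ne'
    have a2 : Complex.exp (θ * Complex.I) = -Complex.exp (-(((μ.im * x₀ : ℝ) : ℂ) * Complex.I)) := by
      apply mul_left_cancel₀ hn'
      rw [a1, mul_neg]
    rw [Complex.exp_pi_mul_I, Complex.ofReal_add, add_mul, Complex.exp_add, a2, neg_mul,
      ← Complex.exp_add, neg_add_cancel, Complex.exp_zero]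
  obtain ⟨n, hnn⟩ := Complex.exp_eq_exp_iff_exists_int.1 h3
  have h4 : θ + μ.im * x₀ = Real.pi + n * (2 * Real.pi) := by
    have := congrArg Complex.im hnn
    simpa using this
  have hpos : 0 < θ + μ.im * x₀ := add_pos hθ.1 (mul_pos him hx₀)
  -- For `n ≤ -1` the right side would be at most `-π`, while the left side is positive.
  have hn0 : 0 ≤ n := by
    by_contra hc
    have : (n : ℝ) ≤ -1 := by exact_mod_cast Int.le_sub_one_of_lt (not_le.1 hc)
    nlinarith [Real.pi_pos]
  lift n to ℕ using hn0
  have hs := sin_pos_of_mem_Ioc (Ioo_subset_Ioc_self hθ)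
  have hr : branchRadius n θ = ‖μ‖ * x₀ := by
    rw [branchRadius, div_eq_iff hs.ne']
    rw [hμim] at h4
    push_cast at h4
    linarith
  refine ⟨n, θ, hθ, ?_, ?_⟩
  · rw [branchParam, hr]
    have e3 : Real.exp (-(μ.re * x₀)) * Real.exp (μ.re * x₀) = 1 := by
      rw [← Real.exp_add, neg_add_cancel, Real.exp_zero]
    have e4 : ‖μ‖ * x₀ * Real.cos θ = μ.re * x₀ := by rw [hμre]; ring
    rw [e4]
    calc 2 / x₀ * (‖μ‖ * x₀ * Real.exp (μ.re * x₀)) = 2 * ‖μ‖ * Real.exp (μ.re * x₀) := by field_simp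
      _ = β := by rw [h2, mul_assoc, e3, mul_one]
  · rw [branchRoot, hr, mul_div_cancel_right₀ _ hx₀.ne', hμ]

/-- The equation has real coefficients, so conjugation reduces to roots in the open first quadrant;
a positive real `μ` makes the left side positive. -/
theorem mem_pointSpec_iff_branch {x₀ : ℝ} (hx₀ : 0 < x₀) {β : ℝ} (hβ : 0 ≤ β) {z : ℂ} :
    z ∈ pointSpec (-opA x₀ β) ↔ ∃ k, branchParam x₀ k (Real.pi / 2) < β ∧
      (z = branchEigenvalue x₀ k β ∨ z = (starRingEnd ℂ) (branchEigenvalue x₀ k β)) := by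
  rw [mem_pointSpec_iff_exists hx₀]
  have upper : ∀ μ : ℂ, 0 < μ.re → 0 < μ.im → 2 * μ + β * Complex.exp (-(μ * x₀)) = 0 →
      ∃ k, branchParam x₀ k (Real.pi / 2) < β ∧ μ ^ 2 = branchEigenvalue x₀ k β := by
    intro μ h1 h2 h
    obtain ⟨k, θ, hθ, rfl, rfl⟩ := exists_branchRoot_eq hx₀ hβ h1 h2 h
    refine ⟨k, branchParam_half_pi_lt hx₀ k hθ, ?_⟩
    rw [branchEigenvalue, branchAngle_branchParam hx₀ k hθ]
  have conj_root : ∀ μ : ℂ, 2 * μ + β * Complex.exp (-(μ * x₀)) = 0 →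
      2 * (starRingEnd ℂ) μ + β * Complex.exp (-((starRingEnd ℂ) μ * x₀)) = 0 := by
    intro μ h
    have := congrArg (starRingEnd ℂ) h
    simpa [← Complex.exp_conj, map_ofNat] using this
  constructor
  · rintro ⟨μ, hre, rfl, h⟩
    rcases lt_trichotomy μ.im 0 with him | him | him
    · obtain ⟨k, hk, e⟩ := upper ((starRingEnd ℂ) μ) (by simpa using hre) (by simpa using him)
        (conj_root μ h)
      refine ⟨k, hk, Or.inr ?_⟩
      rw [← e, map_pow, Complex.conj_conj]
    · exfalso
      have hμ : μ = (μ.re : ℂ) := by apply Complex.ext <;> simp [him]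
      rw [hμ] at h
      have h2 : 2 * μ.re + β * Real.exp (-(μ.re * x₀)) = 0 := by exact_mod_cast h
      have := mul_nonneg hβ (Real.exp_pos (-(μ.re * x₀))).le
      linarith
    · obtain ⟨k, hk, e⟩ := upper μ hre him h
      exact ⟨k, hk, Or.inl e⟩
  · rintro ⟨k, hk, hz⟩
    have hθ := branchAngle_mem hx₀ hk
    have hroot := branchRoot_isRoot hx₀ k (Ioo_subset_Ioc_self hθ)
    rw [branchParam_branchAngle hx₀ hk] at hroot
    rcases hz with rfl | rfl
    · exact ⟨_, re_branchRoot_pos hx₀ k hθ, rfl, hroot⟩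
    · exact ⟨_, by simpa using re_branchRoot_pos hx₀ k hθ, by rw [branchEigenvalue, map_pow],
        conj_root _ hroot⟩

theorem eq_of_sq_eq_sq_of_re_pos {μ ν : ℂ} (hμ : 0 < μ.re) (hν : 0 < ν.re) (h : μ ^ 2 = ν ^ 2) :
    μ = ν := by
  rcases sq_eq_sq_iff_eq_or_eq_neg.1 h with h | h
  · exact h
  · rw [h] at hμ
    simp at hμ
    linarith

/-- An eigenvalue determines its root `μ` in the right half-plane, and the equation for `μ` is
affine in `β` with nonvanishing coefficient. -/
theorem disjoint_pointSpec {x₀ : ℝ} (hx₀ : 0 < x₀) {β β' : ℝ} (h : β ≠ β') :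
    Disjoint (pointSpec (-opA x₀ β)) (pointSpec (-opA x₀ β')) := by
  rw [Set.disjoint_left]
  intro z hz hz'
  obtain ⟨μ, hμ, rfl, e⟩ := (mem_pointSpec_iff_exists hx₀).1 hz
  obtain ⟨ν, hν, hνμ, e'⟩ := (mem_pointSpec_iff_exists hx₀).1 hz'
  obtain rfl := eq_of_sq_eq_sq_of_re_pos hν hμ hνμ
  apply h
  have h1 : (β : ℂ) * Complex.exp (-(ν * x₀)) = β' * Complex.exp (-(ν * x₀)) := by
    linear_combination e - e'
  exact_mod_cast mul_right_cancel₀ (Complex.exp_ne_zero _) h1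

theorem re_branchEigenvalue (x₀ : ℝ) (k : ℕ) (β : ℝ) :
    (branchEigenvalue x₀ k β).re = (branchRadius k (branchAngle x₀ k β) / x₀) ^ 2 *
      Real.cos (2 * branchAngle x₀ k β) := by
  rw [branchEigenvalue, branchRoot_sq, Complex.re_ofReal_mul, Complex.exp_ofReal_mul_I_re]

theorem im_branchEigenvalue (x₀ : ℝ) (k : ℕ) (β : ℝ) :
    (branchEigenvalue x₀ k β).im = (branchRadius k (branchAngle x₀ k β) / x₀) ^ 2 *
      Real.sin (2 * branchAngle x₀ k β) := by
  rw [branchEigenvalue, branchRoot_sq, Complex.im_ofReal_mul, Complex.exp_ofReal_mul_I_im]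

theorem radius_div_sq_pos {x₀ : ℝ} (hx₀ : 0 < x₀) {k : ℕ} {β : ℝ}
    (hβ : branchParam x₀ k (Real.pi / 2) < β) :
    0 < (branchRadius k (branchAngle x₀ k β) / x₀) ^ 2 :=
  pow_pos (div_pos (branchRadius_pos (Ioo_subset_Ioc_self (branchAngle_mem hx₀ hβ))) hx₀) 2

theorem im_branchEigenvalue_pos {x₀ : ℝ} (hx₀ : 0 < x₀) {k : ℕ} {β : ℝ}
    (hβ : branchParam x₀ k (Real.pi / 2) < β) : 0 < (branchEigenvalue x₀ k β).im := by
  have h := branchAngle_mem hx₀ hβ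
  rw [im_branchEigenvalue]
  exact mul_pos (radius_div_sq_pos hx₀ hβ)
    (Real.sin_pos_of_pos_of_lt_pi (by linarith [h.1]) (by linarith [h.2]))

theorem arg_branchEigenvalue {x₀ : ℝ} (hx₀ : 0 < x₀) {k : ℕ} {β : ℝ}
    (hβ : branchParam x₀ k (Real.pi / 2) < β) :
    Complex.arg (branchEigenvalue x₀ k β) = 2 * branchAngle x₀ k β := by
  have h := branchAngle_mem hx₀ hβ
  rw [branchEigenvalue, branchRoot_sq, Complex.arg_real_mul _ (radius_div_sq_pos hx₀ hβ),
    Complex.arg_exp_mul_I, toIocMod_eq_self]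
  constructor <;> linarith [h.1, h.2, Real.pi_pos]

theorem norm_branchEigenvalue (x₀ : ℝ) (k : ℕ) (β : ℝ) :
    ‖branchEigenvalue x₀ k β‖ = (branchRadius k (branchAngle x₀ k β) / x₀) ^ 2 := by
  rw [branchEigenvalue, branchRoot_sq, norm_mul, Complex.norm_exp_ofReal_mul_I, Complex.norm_real,
    Real.norm_of_nonneg (sq_nonneg _), mul_one]

/-- Equal arguments give the same `θ`, equal norms the same radius, and at fixed `θ` the radius is
strictly increasing in the branch number. -/
theorem branchEigenvalue_injective {x₀ : ℝ} (hx₀ : 0 < x₀) {j k : ℕ} {β : ℝ}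
    (hj : branchParam x₀ j (Real.pi / 2) < β) (hk : branchParam x₀ k (Real.pi / 2) < β)
    (h : branchEigenvalue x₀ j β = branchEigenvalue x₀ k β) : j = k := by
  have h1 := congrArg Complex.arg h
  have h2 := congrArg norm h
  have hm := Ioo_subset_Ioc_self (branchAngle_mem hx₀ hj)
  rw [arg_branchEigenvalue hx₀ hj, arg_branchEigenvalue hx₀ hk] at h1
  have h3 : branchAngle x₀ k β = branchAngle x₀ j β := by linarith
  rw [norm_branchEigenvalue, norm_branchEigenvalue, h3, sq_eq_sq₀
    (div_pos (branchRadius_pos hm) hx₀).le (div_pos (branchRadius_pos hm) hx₀).le,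
    div_left_inj' hx₀.ne'] at h2
  exact (strictMono_branchRadius hm).injective h2

theorem continuousAt_branchEigenvalue {x₀ : ℝ} (hx₀ : 0 < x₀) {k : ℕ} {β : ℝ}
    (hβ : branchParam x₀ k (Real.pi / 2) < β) : ContinuousAt (branchEigenvalue x₀ k) β := by
  have h1 : ContinuousAt (fun β => branchRoot x₀ k (branchAngle x₀ k β)) β :=
    ContinuousAt.comp (f := branchAngle x₀ k)
      (continuousAt_branchRoot (Ioo_subset_Ioc_self (branchAngle_mem hx₀ hβ)))
      (continuousAt_branchAngle hx₀ hβ)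
  exact h1.pow 2

/-- At the threshold `θ` tends to `π/2`, where the root is purely imaginary and its square negative.
-/
theorem tendsto_branchEigenvalue {x₀ : ℝ} (hx₀ : 0 < x₀) (k : ℕ) :
    ∃ r : ℝ, r < 0 ∧ Tendsto (branchEigenvalue x₀ k) (𝓝[>] (branchParam x₀ k (Real.pi / 2)))
      (𝓝 (r : ℂ)) := by
  have hm : Real.pi / 2 ∈ Ioc 0 (Real.pi / 2) := ⟨by positivity, le_rfl⟩
  refine ⟨-(branchRadius k (Real.pi / 2) / x₀) ^ 2,
    neg_neg_of_pos (pow_pos (div_pos (branchRadius_pos hm) hx₀) 2), ?_⟩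
  have h := (((continuousAt_branchRoot (x₀ := x₀) (k := k) hm).tendsto.comp
    (tendsto_branchAngle_half_pi hx₀ k)).pow 2)
  rw [branchRoot_sq] at h
  have e : (((branchRadius k (Real.pi / 2) / x₀) ^ 2 : ℝ) : ℂ) *
      Complex.exp ((2 * (Real.pi / 2) : ℝ) * Complex.I) =
      ((-(branchRadius k (Real.pi / 2) / x₀) ^ 2 : ℝ) : ℂ) := by
    rw [mul_div_cancel₀ _ two_ne_zero, Complex.exp_pi_mul_I]
    push_cast; ring
  rw [e] at h
  exact h

/-- The imaginary part equals `2 ((2k+1)π - θ)² cos θ / (x₀² sin θ)`, and `θ` decreases to `0`. -/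
theorem tendsto_im_branchEigenvalue {x₀ : ℝ} (hx₀ : 0 < x₀) (k : ℕ) :
    Tendsto (fun β => (branchEigenvalue x₀ k β).im) atTop atTop := by
  have hpi := Real.pi_pos
  have h0 : Tendsto (fun θ => 2 / x₀ ^ 2 * ((2 * k + 1) * Real.pi - θ) ^ 2 * Real.cos θ)
      (𝓝[>] 0) (𝓝 (2 / x₀ ^ 2 * ((2 * k + 1) * Real.pi) ^ 2)) := by
    have hc : Continuous fun θ => 2 / x₀ ^ 2 * ((2 * k + 1) * Real.pi - θ) ^ 2 * Real.cos θ := by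
      fun_prop
    have := (hc.tendsto 0).mono_left (nhdsWithin_le_nhds (s := Ioi 0))
    simpa using this
  have h1 : Tendsto (fun θ => (Real.sin θ)⁻¹) (𝓝[>] 0) atTop := by
    refine tendsto_inv_nhdsGT_zero.comp (tendsto_nhdsWithin_iff.2 ⟨?_, ?_⟩)
    · have := (Real.continuous_sin.tendsto 0).mono_left (nhdsWithin_le_nhds (s := Ioi 0))
      simpa using this
    · filter_upwards [Ioo_mem_nhdsGT hpi] with θ hθ
      exact Real.sin_pos_of_mem_Ioo hθ
  have h2 := (h0.pos_mul_atTop (by positivity) h1).comp (tendsto_branchAngle_zero hx₀ k)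
  refine h2.congr' ?_
  filter_upwards [eventually_gt_atTop (branchParam x₀ k (Real.pi / 2))] with β hβ
  have hm := Ioo_subset_Ioc_self (branchAngle_mem hx₀ hβ)
  have hs := (sin_pos_of_mem_Ioc hm).ne'
  rw [im_branchEigenvalue, Function.comp_apply, ← branchRadius_mul_sin hm, Real.sin_two_mul]
  field_simp

theorem re_branchEigenvalue_neg {x₀ : ℝ} (hx₀ : 0 < x₀) {k : ℕ} {β : ℝ}
    (hβ : branchParam x₀ k (Real.pi / 2) < β) (h : β < branchParam x₀ k (Real.pi / 4)) :
    (branchEigenvalue x₀ k β).re < 0 := by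
  have hpi := Real.pi_pos
  have hm := branchAngle_mem hx₀ hβ
  have h1 := (lt_branchAngle_iff hx₀ hβ (θ := Real.pi / 4) ⟨by positivity, by linarith⟩).2 h
  rw [re_branchEigenvalue]
  exact mul_neg_of_pos_of_neg (radius_div_sq_pos hx₀ hβ)
    (Real.cos_neg_of_pi_div_two_lt_of_lt (by linarith) (by linarith [hm.2]))

theorem re_branchEigenvalue_pos {x₀ : ℝ} (hx₀ : 0 < x₀) {k : ℕ} {β : ℝ}
    (hβ : branchParam x₀ k (Real.pi / 2) < β) (h : branchParam x₀ k (Real.pi / 4) < β) :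
    0 < (branchEigenvalue x₀ k β).re := by
  have hpi := Real.pi_pos
  have hm := branchAngle_mem hx₀ hβ
  have h1 := (branchAngle_lt_iff hx₀ hβ (θ := Real.pi / 4) ⟨by positivity, by linarith⟩).2 h
  rw [re_branchEigenvalue]
  exact mul_pos (radius_div_sq_pos hx₀ hβ)
    (Real.cos_pos_of_mem_Ioo ⟨by linarith [hm.1], by linarith⟩)

theorem re_branchEigenvalue_crossing {x₀ : ℝ} (hx₀ : 0 < x₀) (k : ℕ) :
    (branchEigenvalue x₀ k (branchParam x₀ k (Real.pi / 4))).re = 0 := by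
  have hpi := Real.pi_pos
  rw [re_branchEigenvalue, branchAngle_branchParam hx₀ k ⟨by positivity, by linarith⟩,
    show 2 * (Real.pi / 4) = Real.pi / 2 by ring, Real.cos_pi_div_two, mul_zero]

theorem branchParam_half_pi (x₀ : ℝ) (k : ℕ) :
    branchParam x₀ k (Real.pi / 2) = 4 * Real.pi / x₀ * k + Real.pi / x₀ := by
  simp [branchParam, branchRadius]
  ring

theorem branchParam_zero_quarter_pi (x₀ : ℝ) :
    branchParam x₀ 0 (Real.pi / 4) = 3 * Real.pi / √2 * Real.exp (3 * Real.pi / 4) / x₀ := by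
  have hr : branchRadius 0 (Real.pi / 4) = 3 * Real.pi / (2 * √2) := by
    rw [branchRadius, Real.sin_pi_div_four]
    field_simp
    push_cast
    ring
  have he : 3 * Real.pi / (2 * √2) * (√2 / 2) = 3 * Real.pi / 4 := by field_simp; norm_num
  rw [branchParam, hr, Real.cos_pi_div_four, he]
  field_simp

theorem tendsto_branchParam_half_pi {x₀ : ℝ} (hx₀ : 0 < x₀) :
    Tendsto (fun k => branchParam x₀ k (Real.pi / 2)) atTop atTop := by
  simp only [branchParam_half_pi]
  exact tendsto_atTop_add_const_right _ _
    (tendsto_natCast_atTop_atTop.const_mul_atTop (by positivity))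

/-- The thresholds tend to infinity, so only finitely many branches have been ejected. -/
theorem finite_pointSpec {x₀ : ℝ} (hx₀ : 0 < x₀) {β : ℝ} (hβ : 0 ≤ β) :
    (pointSpec (-opA x₀ β)).Finite := by
  obtain ⟨N, hN⟩ := eventually_atTop.1 ((tendsto_branchParam_half_pi hx₀).eventually_ge_atTop β)
  refine (((Set.finite_Iio N).image (fun k => branchEigenvalue x₀ k β)).union
    ((Set.finite_Iio N).image (fun k => (starRingEnd ℂ) (branchEigenvalue x₀ k β)))).subset ?_
  intro z hz
  obtain ⟨k, hk, h⟩ := (mem_pointSpec_iff_branch hx₀ hβ).1 hz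
  have hkN : k < N := by
    by_contra hc
    exact absurd (hN k (not_lt.1 hc)) (not_le.2 hk)
  rcases h with rfl | rfl
  · exact Or.inl ⟨k, hkN, rfl⟩
  · exact Or.inr ⟨k, hkN, rfl⟩

theorem im_ne_zero_of_mem_pointSpec {x₀ : ℝ} (hx₀ : 0 < x₀) {β : ℝ} (hβ : 0 ≤ β) {z : ℂ}
    (hz : z ∈ pointSpec (-opA x₀ β)) : z.im ≠ 0 := by
  obtain ⟨k, hk, h⟩ := (mem_pointSpec_iff_branch hx₀ hβ).1 hz
  have := (im_branchEigenvalue_pos hx₀ hk).ne'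
  rcases h with rfl | rfl
  · exact this
  · simpa using this

theorem conj_mem_pointSpec {x₀ : ℝ} (hx₀ : 0 < x₀) {β : ℝ} (hβ : 0 ≤ β) {z : ℂ}
    (hz : z ∈ pointSpec (-opA x₀ β)) : (starRingEnd ℂ) z ∈ pointSpec (-opA x₀ β) := by
  rw [mem_pointSpec_iff_branch hx₀ hβ] at hz ⊢
  obtain ⟨k, hk, h⟩ := hz
  refine ⟨k, hk, ?_⟩
  rcases h with rfl | rfl
  · exact Or.inr rfl
  · exact Or.inl (Complex.conj_conj _)

theorem isClosed_nonposReals : IsClosed nonposReals :=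
  (isClosed_le Complex.continuous_re continuous_const).inter
    (isClosed_eq Complex.continuous_im continuous_const)

theorem eventually_notMem_spec {x₀ : ℝ} (hx₀ : 0 < x₀) {β : ℝ} (hβ : 0 ≤ β) {z : ℂ}
    (hz : z ∈ pointSpec (-opA x₀ β)) : ∀ᶠ w in 𝓝[≠] z, w ∉ spec (-opA x₀ β) := by
  rw [spec_neg_opA hx₀]
  have h1 : ∀ᶠ w in 𝓝[≠] z, w ∉ nonposReals :=
    mem_nhdsWithin_of_mem_nhds (isClosed_nonposReals.isOpen_compl.mem_nhds fun h =>
      im_ne_zero_of_mem_pointSpec hx₀ hβ hz h.2)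
  have h2 : ∀ᶠ w in 𝓝[≠] z, w ∉ pointSpec (-opA x₀ β) \ {z} :=
    mem_nhdsWithin_of_mem_nhds
      (((finite_pointSpec hx₀ hβ).subset sdiff_subset).isClosed.isOpen_compl.mem_nhds (by simp))
  filter_upwards [h1, h2, self_mem_nhdsWithin] with w a1 a2 a3 h
  exact h.elim a1 fun h => a2 ⟨h, a3⟩

end HeatLine

end

/-! ### Assembly of the proposition. -/

theorem proposition2p3 (x₀ β₀ β₁ : ℝ) (hx₀ : 0 < x₀) (hβ₀ : β₀ = Real.pi / x₀)
    (hβ₁ : β₁ = 3 * Real.pi / √2 * Real.exp (3 * Real.pi / 4) / x₀) :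
    β₀ < β₁ ∧
    -- below the first critical value
    (∀ β : ℝ, 0 ≤ β → β < β₀ →
      spec (-opA x₀ β) = nonposReals ∧ contSpec (-opA x₀ β) = nonposReals ∧
      pointSpec (-opA x₀ β) = ∅) ∧
    -- between the two critical values
    (∀ β : ℝ, β₀ < β → β < β₁ →
      contSpec (-opA x₀ β) = nonposReals ∧
      (pointSpec (-opA x₀ β)).Nonempty ∧ (pointSpec (-opA x₀ β)).Finite ∧
      ∀ z ∈ pointSpec (-opA x₀ β), z.im ≠ 0 ∧ z.re < 0 ∧
        (starRingEnd ℂ) z ∈ pointSpec (-opA x₀ β) ∧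
        ∀ᶠ w in 𝓝[≠] z, w ∉ spec (-opA x₀ β)) ∧
    -- the point spectrum varies with the parameter
    (∀ β ∈ Ioo β₀ β₁, ∀ β' ∈ Ioo β₀ β₁, β ≠ β' →
      Disjoint (pointSpec (-opA x₀ β)) (pointSpec (-opA x₀ β'))) ∧
    -- at the second critical value exactly one pair has reached the imaginary axis
    (∃ τ : ℝ, 0 < τ ∧
      {z ∈ pointSpec (-opA x₀ β₁) | 0 ≤ z.re} = {τ * Complex.I, -(τ * Complex.I)}) ∧
    -- all parameters
    (∀ β : ℝ, 0 ≤ β →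
      contSpec (-opA x₀ β) = nonposReals ∧
      spec (-opA x₀ β) = nonposReals ∪ pointSpec (-opA x₀ β) ∧
      (pointSpec (-opA x₀ β)).Finite ∧
      ∀ z ∈ pointSpec (-opA x₀ β), z.im ≠ 0) ∧
    -- the curves traced by the pairs: the pair with number `k` is ejected at `e k`, crosses at `c k`
    ∃ (e c : ℕ → ℝ) (Λ : ℕ → ℝ → ℂ),
      e 0 = β₀ ∧ c 0 = β₁ ∧ StrictMono e ∧ StrictMono c ∧ Tendsto e atTop atTop ∧
      (∀ k, e k < c k) ∧
      (∀ β : ℝ, 0 ≤ β → ∀ z : ℂ, z ∈ pointSpec (-opA x₀ β) ↔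
        ∃ k, e k < β ∧ (z = Λ k β ∨ z = (starRingEnd ℂ) (Λ k β))) ∧
      (∀ j k, ∀ β : ℝ, e j < β → e k < β → Λ j β = Λ k β → j = k) ∧
      ∀ k,
        ContinuousOn (Λ k) (Ioi (e k)) ∧
        (∃ r : ℝ, r < 0 ∧ Tendsto (Λ k) (𝓝[>] (e k)) (𝓝 (r : ℂ))) ∧
        (∀ β, e k < β → 0 < (Λ k β).im) ∧
        StrictAntiOn (fun β => Complex.arg (Λ k β)) (Ioi (e k)) ∧
        (∀ β, e k < β → β < c k → (Λ k β).re < 0) ∧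
        (Λ k (c k)).re = 0 ∧
        (∀ β, c k < β → 0 < (Λ k β).re) ∧
        Tendsto (fun β => (Λ k β).im) atTop atTop := by
  have hpi := Real.pi_pos
  have hhalf : Real.pi / 2 ∈ Ioc 0 (Real.pi / 2) := ⟨by positivity, le_rfl⟩
  have hquarter : Real.pi / 4 ∈ Ioo 0 (Real.pi / 2) := ⟨by positivity, by linarith⟩
  have he : branchParam x₀ 0 (Real.pi / 2) = β₀ := by rw [branchParam_half_pi, hβ₀]; simp
  have hc : branchParam x₀ 0 (Real.pi / 4) = β₁ := by rw [branchParam_zero_quarter_pi, hβ₁]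
  have hlt : β₀ < β₁ := by rw [← he, ← hc]; exact branchParam_half_pi_lt hx₀ 0 hquarter
  have hβ₀0 : 0 < β₀ := by rw [hβ₀]; positivity
  have emono := strictMono_branchParam hx₀ hhalf
  have cmono := strictMono_branchParam hx₀ (Ioo_subset_Ioc_self hquarter)
  refine ⟨hlt, ?_, ?_, ?_, ?_, ?_, ?_⟩
  · intro β hβ hββ
    have hp : pointSpec (-opA x₀ β) = ∅ := by
      rw [eq_empty_iff_forall_notMem]
      intro z hz
      obtain ⟨k, hk, -⟩ := (mem_pointSpec_iff_branch hx₀ hβ).1 hz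
      have h1 : branchParam x₀ 0 (Real.pi / 2) ≤ branchParam x₀ k (Real.pi / 2) :=
        emono.monotone (Nat.zero_le k)
      linarith
    refine ⟨?_, contSpec_neg_opA hx₀ β, hp⟩
    rw [spec_neg_opA hx₀, hp, union_empty]
  · intro β h0 h1
    have hβ : 0 ≤ β := by linarith
    refine ⟨contSpec_neg_opA hx₀ β, ?_, finite_pointSpec hx₀ hβ, fun z hz =>
      ⟨im_ne_zero_of_mem_pointSpec hx₀ hβ hz, ?_, conj_mem_pointSpec hx₀ hβ hz,
        eventually_notMem_spec hx₀ hβ hz⟩⟩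
    · exact ⟨_, (mem_pointSpec_iff_branch hx₀ hβ).2 ⟨0, by rwa [he], Or.inl rfl⟩⟩
    · obtain ⟨k, hk, h⟩ := (mem_pointSpec_iff_branch hx₀ hβ).1 hz
      have h2 : branchParam x₀ 0 (Real.pi / 4) ≤ branchParam x₀ k (Real.pi / 4) :=
        cmono.monotone (Nat.zero_le k)
      have h3 := re_branchEigenvalue_neg hx₀ hk (by linarith)
      rcases h with rfl | rfl
      · exact h3
      · simpa using h3
  · intro β _ β' _ h
    exact disjoint_pointSpec hx₀ h
  · have hk0 : branchParam x₀ 0 (Real.pi / 2) < β₁ := by rwa [he]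
    have hre : (branchEigenvalue x₀ 0 β₁).re = 0 := by
      rw [← hc]; exact re_branchEigenvalue_crossing hx₀ 0
    have hΛ : branchEigenvalue x₀ 0 β₁ = (branchEigenvalue x₀ 0 β₁).im * Complex.I := by
      apply Complex.ext <;> simp [hre]
    have hΛ' : (starRingEnd ℂ) (branchEigenvalue x₀ 0 β₁) =
        -((branchEigenvalue x₀ 0 β₁).im * Complex.I) := by
      apply Complex.ext <;> simp [hre]
    refine ⟨(branchEigenvalue x₀ 0 β₁).im, im_branchEigenvalue_pos hx₀ hk0, ?_⟩
    have hβ : 0 ≤ β₁ := by linarith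
    ext z
    rw [mem_sep_iff, mem_pointSpec_iff_branch hx₀ hβ, mem_insert_iff, mem_singleton_iff, ← hΛ',
      ← hΛ]
    constructor
    · rintro ⟨⟨k, hk, h⟩, hz⟩
      -- Crossing parameters increase strictly with `k`, so at `β₁` every later branch is still in
      -- the left half-plane.
      rcases Nat.eq_zero_or_pos k with rfl | hk1
      · exact h
      · have h2 : branchParam x₀ 0 (Real.pi / 4) < branchParam x₀ k (Real.pi / 4) := cmono hk1
        have h3 := re_branchEigenvalue_neg hx₀ hk (by linarith)
        rcases h with rfl | rfl
        · linarith
        · rw [Complex.conj_re] at hz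
          linarith
    · intro h
      refine ⟨⟨0, hk0, h⟩, ?_⟩
      rcases h with rfl | rfl
      · exact hre.ge
      · rw [Complex.conj_re, hre]
  · intro β hβ
    exact ⟨contSpec_neg_opA hx₀ β, spec_neg_opA hx₀ β, finite_pointSpec hx₀ hβ,
      fun z hz => im_ne_zero_of_mem_pointSpec hx₀ hβ hz⟩
  · refine ⟨fun k => branchParam x₀ k (Real.pi / 2), fun k => branchParam x₀ k (Real.pi / 4),
      branchEigenvalue x₀, he, hc, emono, cmono, tendsto_branchParam_half_pi hx₀,
      fun k => branchParam_half_pi_lt hx₀ k hquarter,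
      fun β hβ z => mem_pointSpec_iff_branch hx₀ hβ,
      fun j k β hj hk h => branchEigenvalue_injective hx₀ hj hk h, fun k => ⟨?_,
      tendsto_branchEigenvalue hx₀ k, fun β hβ => im_branchEigenvalue_pos hx₀ hβ, ?_,
      fun β hβ h => re_branchEigenvalue_neg hx₀ hβ h, re_branchEigenvalue_crossing hx₀ k, ?_,
      tendsto_im_branchEigenvalue hx₀ k⟩⟩
    · exact fun β hβ => (continuousAt_branchEigenvalue hx₀ hβ).continuousWithinAt
    · intro a ha b hb hab
      have := strictAntiOn_branchAngle hx₀ k ha hb hab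
      simp only [arg_branchEigenvalue hx₀ ha, arg_branchEigenvalue hx₀ hb]
      linarith
    · exact fun β h =>
        re_branchEigenvalue_pos hx₀ ((branchParam_half_pi_lt hx₀ k hquarter).trans h) h
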